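/- Let $D\subset\mathbb R^n$ be open with Lebesgue measure $1$, let $T>0$, and let $X:[0,T]\times D\to\mathbb R^n$ be a flow map: $X(t,\cdot)$ is measurable for each $t\in[0,T]$, $t\mapsto X(t,y)$ is continuous on $[0,T]$ with a forward derivative $X_t(t,y)$ at every $t\in[0,T)$ for each $y\in D$, and $\sup_{0\le t<T}\int_D|X_t(t,y)|^2\,dy<\infty$. Let $J(X)$ be the completion of $C_c^1([0,T]\times\mathbb R^n)$ with respect to $\|\theta\|_J=\big(\int_0^T\!\int_D\theta(t,X(t,y))^2\,dy\,dt\big)^{1/2}$, and for $t\in[0,T]$ let $J(X,t)$ be the completion of $C_c^1(\mathbb R^n)$ with respect to $\|\phi\|_{J,t}=\big(\int_D\phi(X(t,y))^2\,dy\big)^{1/2}$ (elements being represented by Borel functions). For $g\in L^2(D)$ let $W(X)g$ be the element $v\in J(X)$ such that, for every $t\in[0,T]$, $v(t,\cdot)\in J(X,t)$, $\|v(t,\cdot)\|_{J,t}\le\|g\|_{L^2(D)}$, and $v(t,X(t,\cdot))-g$ is orthogonal in $L^2(D)$ to $\phi\circ X(t,\cdot)$ for all $\phi\in J(X,t)$;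 for vector-valued $g$ the operator $W(X)$ is applied componentwise. Given a probability measure $\bar\rho$ with finite second moment and $\bar v\in L^2(\bar\rho)$, the map $X$ is a sticky weak solution on $[0,T]$ of the Cauchy problem $$\partial_t\rho+\operatorname{div}(\rho v)=0,\qquad \partial_t(\rho v)+\operatorname{div}(\rho v\otimes v)=0,\qquad \rho(0,\cdot)=\bar\rho,\quad v(0,\cdot)=\bar v,$$ if 1. $X_t=(W(X)X_t(0,\cdot))\circ X$ in $L^2([0,T]\times D)$, where $(v\circ X)(t,y)=v(t,X(t,y))$; 2. for every $\phi\in J(X,0)$, $\int_D\phi(X(0,y))\,dy=\int\phi\,d\bar\rho$ and $\int_D X_t(0,y)\,\phi(X(0,y))\,dy=\int\bar v\,\phi\,d\bar\rho$; 3. whenever $X(t_0,y_1)=X(t_0,y_2)$ with $y_1,y_2\in D$ and $t_0\in[0,T]$, one has $X(t,y_1)=X(t,y_2)$ for all $t\in[t_0,T]$. **Theorem.** In every dimension $n\ge 2$ there exist a probability density $\bar\rho\in C_c^\infty(\mathbb R^n)$ and a continuous, compactly supported velocity $\bar v:\mathbb R^n\to\mathbb R^n$ such that, for every $T>0$, the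 Cauchy problem with data $(\bar\rho,\bar v)$ has two distinct sticky weak solutions $X^1,X^2$ on $[0,T]$ (with a common domain $D$); they are distinct in the sense that the mass distributions $X^1(t,\cdot)_\#\mathcal L_n$ and $X^2(t,\cdot)_\#\mathcal L_n$ (the push-forwards of Lebesgue measure $\mathcal L_n$ on $D$) differ for some $t\in[0,T]$. -/

import Mathlib

open MeasureTheory

namespace PressurelessGas

/-- Euclidean space of dimension `n`. -/
abbrev E (n : ℕ) : Type := EuclideanSpace ℝ (Fin n)

variable {n : ℕ}

/-- The forward (right) time derivative `X_t(t, y)` of a flow map. -/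
noncomputable def fwdDeriv (X : ℝ → E n → E n) (t : ℝ) (y : E n) : E n :=
  derivWithin (fun s => X s y) (Set.Ici t) t

/-- Flow maps `X : [0,T] × D → ℝⁿ` over an open set `D` of Lagrangian coordinates with
Lebesgue measure one. Only the values of `X` on `[0,T] × D` are relevant. Every trajectory is
continuous on `[0,T]` and has a forward derivative at every time `t ∈ [0,T)`; the kinetic energy
is bounded uniformly in time. -/
structure IsFlow (T : ℝ) (D : Set (E n)) (X : ℝ → E n → E n) : Prop where
  isOpen_domain : IsOpen D
  volume_domain : volume D = 1
  aemeasurable : ∀ t ∈ Set.Icc 0 T, AEMeasurable (X t) (volume.restrict D)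
  continuousOn : ∀ y ∈ D, ContinuousOn (fun t => X t y) (Set.Icc 0 T)
  hasFwdDeriv : ∀ y ∈ D, ∀ t ∈ Set.Ico 0 T,
    DifferentiableWithinAt ℝ (fun s => X s y) (Set.Ici t) t
  energy_bound : (⨆ t ∈ Set.Ico 0 T, ∫⁻ y in D, ‖fwdDeriv X t y‖ₑ ^ 2) < ⊤

/-- Lebesgue measure on `[0,T] × D`. -/
noncomputable def slab (T : ℝ) (D : Set (E n)) : Measure (ℝ × E n) :=
  (volume.restrict (Set.Icc 0 T)).prod (volume.restrict D)

/-- `v` represents an element of `J(X)`, the completion of `C_c^1([0,T] × ℝⁿ)` for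
`‖θ‖_J = ‖θ(t, X(t,y))‖_{L²([0,T] × D)}`: a Borel function which is a limit, for this norm, of
test functions. A `C_c^1` function on the closed slab `[0,T] × ℝⁿ` is given as
the restriction of a `C_c^1` function on `ℝ × ℝⁿ`. -/
def MemJ (T : ℝ) (D : Set (E n)) (X : ℝ → E n → E n) (v : ℝ → E n → ℝ) : Prop :=
  Measurable (Function.uncurry v) ∧
  ∀ ε : ENNReal, 0 < ε → ∃ θ : ℝ × E n → ℝ, ContDiff ℝ 1 θ ∧ HasCompactSupport θ ∧
    eLpNorm (fun p : ℝ × E n => v p.1 (X p.1 p.2) - θ (p.1, X p.1 p.2)) 2 (slab T D) < ε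

/-- `φ` represents an element of the section `J(X,t)`, the completion of `C_c^1(ℝⁿ)` for
`‖φ‖_{J,t} = ‖φ(X(t,y))‖_{L²(D)}`. -/
def MemJAt (D : Set (E n)) (X : ℝ → E n → E n) (t : ℝ) (φ : E n → ℝ) : Prop :=
  Measurable φ ∧
  ∀ ε : ENNReal, 0 < ε → ∃ θ : E n → ℝ, ContDiff ℝ 1 θ ∧ HasCompactSupport θ ∧
    eLpNorm (fun y => φ (X t y) - θ (X t y)) 2 (volume.restrict D) < ε

/-- `v = W(X) g` for a scalar `g ∈ L²(D)`: `v ∈ J(X)` and, for every `t ∈ [0,T]`,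
`v(t,·) ∈ J(X,t)`, `‖v(t,·)‖_{J,t} ≤ ‖g‖_{L²(D)}`, and `v(t, X(t,·)) - g` is orthogonal in `L²(D)`
to `K(X,t) = {φ ∘ X(t,·) : φ ∈ J(X,t)}`. -/
structure IsW (T : ℝ) (D : Set (E n)) (X : ℝ → E n → E n) (g : E n → ℝ)
    (v : ℝ → E n → ℝ) : Prop where
  memLp : MemLp g 2 (volume.restrict D)
  memJ : MemJ T D X v
  memJAt : ∀ t ∈ Set.Icc 0 T, MemJAt D X t (v t)
  norm_le : ∀ t ∈ Set.Icc 0 T,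
    eLpNorm (fun y => v t (X t y)) 2 (volume.restrict D) ≤ eLpNorm g 2 (volume.restrict D)
  orthogonal : ∀ t ∈ Set.Icc 0 T, ∀ φ : E n → ℝ, MemJAt D X t φ →
    ∫ y in D, (v t (X t y) - g y) * φ (X t y) = 0

/-- Sticky weak solutions on `[0,T]` of the pressureless gas system with initial mass
distribution `ρ₀` and initial velocity `v₀`. The operator `W(X)` acts on the velocity
component by component. -/
structure IsStickyWeakSolution (T : ℝ) (ρ₀ : Measure (E n)) (v₀ : E n → E n)
    (D : Set (E n)) (X : ℝ → E n → E n) : Prop where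
  isFlow : IsFlow T D X
  weak : ∃ v : ℝ → E n → E n,
    (∀ i : Fin n, IsW T D X (fun y => fwdDeriv X 0 y i) (fun t x => v t x i)) ∧
    ∀ᵐ p : ℝ × E n ∂(slab T D), fwdDeriv X p.1 p.2 = v p.1 (X p.1 p.2)
  initial_mass : ∀ φ : E n → ℝ, MemJAt D X 0 φ →
    ∫ y in D, φ (X 0 y) = ∫ x, φ x ∂ρ₀
  initial_momentum : ∀ φ : E n → ℝ, MemJAt D X 0 φ →
    ∫ y in D, φ (X 0 y) • fwdDeriv X 0 y = ∫ x, φ x • v₀ x ∂ρ₀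
  sticky : ∀ y₁ ∈ D, ∀ y₂ ∈ D, ∀ t₀ ∈ Set.Icc 0 T, X t₀ y₁ = X t₀ y₂ →
    ∀ t ∈ Set.Icc t₀ T, X t y₁ = X t y₂

/-- The mass distribution `ρ(t,·)` at time `t`: the push-forward of Lebesgue measure on `D`
by `X(t,·)`. -/
noncomputable def massAt (D : Set (E n)) (X : ℝ → E n → E n) (t : ℝ) : Measure (E n) :=
  (volume.restrict D).map (X t)

end PressurelessGas

open MeasureTheory

namespace PressurelessGas

variable {n : ℕ}

open Set Metric Topology

/-! Think first of point particles with scales `s_k = 2^{-k}`. Particle `k` moves in the plane of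
the first two axes: its coordinate along `axis k` is `s_{k+1}^2 - s_{k+1} t`, and along `axis (k+1)`
it is `s_{k+2}^2 - s_{k+2} t`. Two functions `s^2 - s t` and `s'^2 - s' t` with `s ≠ s'` agree
exactly at `t = s + s'`. Hence `k` and `k+1` share one coordinate forever and, moving freely,
collide at time `s_{k+1} + s_{k+3}`. Particle `k` would also collide with `k-1`, but at twice that
time, and only if it has not been deflected before by sticking to `k+1`. Collision times tend to
zero, so there is no first collision to decide which ones occur. Two histories are consistent: the
pairs `{0,1}, {2,3}, …` merge, or `0` stays alone and `{1,2}, {3,4}, …` merge.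

Consistency rests on the separation lemma `not_clusterIndex_lt`. Two clusters `K < J` of one pairing
have their shared coordinates along the same axis, and these agree at a single time, when the finer
cluster `J` has already merged and `K` has not. The other coordinate of the merged cluster then lies
strictly between those of its free constituents, while each particle of `K` has it outside this open
interval, so they miss each other.

To obtain a smooth density, each particle is replaced by a small blob with velocity `w_k - (x -
c_k)/τ_k`, which shrinks to its centre at time `τ_k`, before its merger in either pairing. Being
symmetric, the blob has mean velocity `w_k`, and mergers conserve momentum. This makes the velocity
the orthogonal projection of the initial velocity onto functions of the current position
(`integral_smul_flowVel_sub`), whence `isStickyWeakSolution`. The masses are distinguished by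
`massAt_ne` at a time when particles `2j` and `2j+1` have merged in one history and not in the
other; `j` large makes this time smaller than any `T`. -/

/-! ### Trajectories of blobs which focus and merge in pairs -/

/-- A path which moves with velocity `w` up to time `T`, and with velocity `W` afterwards. -/
noncomputable def kinkPath (c w W : E n) (T t : ℝ) : E n :=
  c + t • w + max 0 (t - T) • (W - w)

/-- The contraction ratio at time `t` of a blob which focuses at time `τ`. -/
noncomputable def shrink (τ t : ℝ) : ℝ := max 0 (1 - t / τ)

/-- Countably many blobs `closedBall (c k) (r k)`. The `k`-th blob has mass `m k` and mean velocity
`w k`; it focuses to a point at time `τ k`, and at time `T k` it merges with its partner `p k`,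
to move on with the velocity `W k`. -/
structure Clustering (n : ℕ) where
  c : ℕ → E n
  w : ℕ → E n
  W : ℕ → E n
  r : ℕ → ℝ
  τ : ℕ → ℝ
  T : ℕ → ℝ
  m : ℕ → ℝ
  p : ℕ → ℕ
  M : ℝ
  τ_pos : ∀ k, 0 < τ k
  τ_le : ∀ k, τ k ≤ T k
  p_p : ∀ k, p (p k) = k
  T_p : ∀ k, T (p k) = T k
  W_p : ∀ k, W (p k) = W k
  meet : ∀ k, c k + T k • w k = c (p k) + T k • w (p k)
  balance : ∀ k, m k • W k + m (p k) • W (p k) = m k • w k + m (p k) • w (p k)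
  norm_w_le : ∀ k, ‖w k‖ ≤ M
  norm_W_le : ∀ k, ‖W k‖ ≤ M
  -- This bounds the contraction speed `r k / τ k`, hence the kinetic energy, uniformly in `k`.
  r_le : ∀ k, r k ≤ M * τ k
  -- All the geometry needed later: blobs have a common point only if they coincide or are partners
  -- that have already merged.
  sep : ∀ t, 0 ≤ t → ∀ k j z,
    ‖z - kinkPath (c k) (w k) (W k) (T k) t‖ ≤ shrink (τ k) t * r k →
    ‖z - kinkPath (c j) (w j) (W j) (T j) t‖ ≤ shrink (τ j) t * r j →
    j = k ∨ (j = p k ∧ T k ≤ t)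

lemma shrink_nonneg (τ t : ℝ) : 0 ≤ shrink τ t := le_max_left _ _

lemma shrink_of_le {τ t : ℝ} (hτ : 0 < τ) (h : τ ≤ t) : shrink τ t = 0 := by
  have : 1 ≤ t / τ := by rwa [le_div_iff₀ hτ, one_mul]
  exact max_eq_left (by linarith)

lemma shrink_of_ge {τ t : ℝ} (hτ : 0 < τ) (h : t ≤ τ) : shrink τ t = 1 - t / τ := by
  have : t / τ ≤ 1 := by rwa [div_le_iff₀ hτ, one_mul]
  exact max_eq_right (by linarith)

/-- The derivative is one-sided, so at the kink `t = T` it already has its later value; the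
conventions in `meanVel` and `trajVel` follow this. -/
lemma hasDerivWithinAt_max_sub (T t : ℝ) :
    HasDerivWithinAt (fun s => max 0 (s - T)) (if T ≤ t then 1 else 0) (Ici t) t := by
  split_ifs with h
  · have h1 : HasDerivWithinAt (fun s : ℝ => s - T) 1 (Ici t) t :=
      ((hasDerivAt_id t).sub_const T).hasDerivWithinAt
    refine h1.congr (fun s hs => max_eq_right ?_) (max_eq_right ?_)
    · have : t ≤ s := hs
      linarith
    · linarith
  · have h1 : HasDerivWithinAt (fun _ : ℝ => (0 : ℝ)) 0 (Ici t) t :=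
      hasDerivWithinAt_const _ _ _
    refine h1.congr_of_eventuallyEq ?_ (max_eq_left (by linarith))
    filter_upwards [nhdsWithin_le_nhds (Iio_mem_nhds (not_le.1 h))] with s hs
    have : s < T := hs
    exact max_eq_left (by linarith)

lemma hasDerivWithinAt_shrink {τ : ℝ} (hτ : 0 < τ) (t : ℝ) :
    HasDerivWithinAt (shrink τ) (if t < τ then -(1 / τ) else 0) (Ici t) t := by
  split_ifs with h
  · have h1 : HasDerivWithinAt (fun s : ℝ => 1 - s / τ) (-(1 / τ)) (Ici t) t :=
      (((hasDerivAt_id t).div_const τ).const_sub 1).hasDerivWithinAt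
    refine h1.congr_of_eventuallyEq ?_ (shrink_of_ge hτ h.le)
    filter_upwards [nhdsWithin_le_nhds (Iio_mem_nhds h)] with s hs
    exact shrink_of_ge hτ (le_of_lt hs)
  · have h1 : HasDerivWithinAt (fun _ : ℝ => (0 : ℝ)) 0 (Ici t) t :=
      hasDerivWithinAt_const _ _ _
    exact h1.congr (fun s hs => shrink_of_le hτ ((not_lt.1 h).trans hs))
      (shrink_of_le hτ (not_lt.1 h))

@[fun_prop]
lemma continuous_shrink (τ : ℝ) : Continuous (shrink τ) := by
  unfold shrink; fun_prop

@[fun_prop]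
lemma continuous_kinkPath (c w W : E n) (T : ℝ) : Continuous (kinkPath c w W T) := by
  unfold kinkPath; fun_prop

namespace Clustering

variable (C : Clustering n)

noncomputable def center (k : ℕ) (t : ℝ) : E n := kinkPath (C.c k) (C.w k) (C.W k) (C.T k) t

/-- The mean velocity of the `k`-th blob. -/
noncomputable def meanVel (k : ℕ) (t : ℝ) : E n :=
  C.w k + (if C.T k ≤ t then (1 : ℝ) else 0) • (C.W k - C.w k)

/-- The trajectory of the point `x` of the `k`-th blob. -/
noncomputable def traj (k : ℕ) (t : ℝ) (x : E n) : E n :=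
  C.center k t + shrink (C.τ k) t • (x - C.c k)

/-- The forward derivative of the trajectory of the point `x` of the `k`-th blob. -/
noncomputable def trajVel (k : ℕ) (t : ℝ) (x : E n) : E n :=
  C.meanVel k t + (if t < C.τ k then -(1 / C.τ k) else 0) • (x - C.c k)

lemma hasDerivWithinAt_traj (k : ℕ) (t : ℝ) (x : E n) :
    HasDerivWithinAt (fun s => C.traj k s x) (C.trajVel k t x) (Ici t) t := by
  have h1 : HasDerivWithinAt (fun s : ℝ => C.c k + s • C.w k) (C.w k) (Ici t) t := by
    simpa using (((hasDerivAt_id t).smul_const (C.w k)).const_add (C.c k)).hasDerivWithinAt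
  exact (h1.add ((hasDerivWithinAt_max_sub (C.T k) t).smul_const _)).add
    ((hasDerivWithinAt_shrink (C.τ_pos k) t).smul_const _)

lemma continuous_traj (k : ℕ) (x : E n) : Continuous fun t => C.traj k t x := by
  unfold traj center; fun_prop

lemma T_pos (k : ℕ) : 0 < C.T k := (C.τ_pos k).trans_le (C.τ_le k)

lemma M_nonneg : 0 ≤ C.M := (norm_nonneg _).trans (C.norm_w_le 0)

lemma norm_meanVel_le (k : ℕ) (t : ℝ) : ‖C.meanVel k t‖ ≤ C.M := by
  unfold meanVel
  split_ifs
  · simpa using C.norm_W_le k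
  · simpa using C.norm_w_le k

lemma meanVel_of_lt {k : ℕ} {t : ℝ} (h : t < C.T k) : C.meanVel k t = C.w k := by
  simp [meanVel, not_le.2 h]

lemma meanVel_of_le {k : ℕ} {t : ℝ} (h : C.T k ≤ t) : C.meanVel k t = C.W k := by
  simp [meanVel, h]

lemma traj_zero (k : ℕ) (x : E n) : C.traj k 0 x = x := by
  simp [traj, center, kinkPath, shrink, (C.T_pos k).le]

lemma trajVel_zero (k : ℕ) (x : E n) :
    C.trajVel k 0 x = C.w k - (1 / C.τ k) • (x - C.c k) := by
  simp only [trajVel, C.meanVel_of_lt (C.T_pos k), C.τ_pos k, if_true, neg_smul, sub_eq_add_neg]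

lemma traj_of_le {k : ℕ} {t : ℝ} (h : C.τ k ≤ t) (x : E n) : C.traj k t x = C.center k t := by
  simp [traj, shrink_of_le (C.τ_pos k) h]

lemma trajVel_of_le {k : ℕ} {t : ℝ} (h : C.τ k ≤ t) (x : E n) :
    C.trajVel k t x = C.meanVel k t := by
  simp [trajVel, not_lt.2 h]

lemma trajVel_of_lt {k : ℕ} {t : ℝ} (h : t < C.τ k) (x : E n) :
    C.trajVel k t x = C.w k - (1 / C.τ k) • (x - C.c k) := by
  simp only [trajVel, C.meanVel_of_lt (h.trans_le (C.τ_le k)), h, if_true, neg_smul,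
    sub_eq_add_neg]

lemma center_partner {k : ℕ} {t : ℝ} (h : C.T k ≤ t) : C.center (C.p k) t = C.center k t := by
  have h0 : max 0 (t - C.T k) = t - C.T k := max_eq_right (by linarith)
  have hm := C.meet k
  simp only [center, kinkPath, C.T_p, C.W_p, h0]
  have h1 : ∀ (c w : E n), c + t • w + (t - C.T k) • (C.W k - w) =
      (c + C.T k • w) + (t - C.T k) • C.W k := by
    intro c w
    module
  rw [h1, h1, hm]

lemma norm_traj_sub_center_le {k : ℕ} {x : E n} (hx : ‖x - C.c k‖ ≤ C.r k) (t : ℝ) :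
    ‖C.traj k t x - C.center k t‖ ≤ shrink (C.τ k) t * C.r k := by
  rw [traj, add_sub_cancel_left, norm_smul, Real.norm_of_nonneg (shrink_nonneg _ _)]
  gcongr
  exact shrink_nonneg _ _

lemma norm_trajVel_le {k : ℕ} {x : E n} (hx : ‖x - C.c k‖ ≤ C.r k) (t : ℝ) :
    ‖C.trajVel k t x‖ ≤ 2 * C.M := by
  have h1 : ‖(if t < C.τ k then -(1 / C.τ k) else 0) • (x - C.c k)‖ ≤ C.M := by
    split_ifs
    · rw [norm_smul, norm_neg, Real.norm_of_nonneg (by have := C.τ_pos k; positivity),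
        one_div_mul_eq_div, div_le_iff₀ (C.τ_pos k)]
      exact hx.trans (C.r_le k)
    · simpa using C.M_nonneg
  calc _ ≤ _ := norm_add_le _ _
    _ ≤ 2 * C.M := by linarith [C.norm_meanVel_le k t]

/-- By `sep`, a coincidence has three possible causes: the same point of an unfocused blob, a blob
already focused, or partners already merged. Each one persists. -/
lemma traj_sticky {j k : ℕ} {x x' : E n} (hx : ‖x - C.c k‖ ≤ C.r k) (hx' : ‖x' - C.c j‖ ≤ C.r j)
    {t₀ t : ℝ} (h0 : 0 ≤ t₀) (ht : t₀ ≤ t) (h : C.traj k t₀ x = C.traj j t₀ x') :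
    C.traj k t x = C.traj j t x' := by
  rcases C.sep t₀ h0 k j _ (C.norm_traj_sub_center_le hx t₀)
    (h ▸ C.norm_traj_sub_center_le hx' t₀) with rfl | ⟨rfl, hT⟩
  · rcases lt_or_ge t₀ (C.τ j) with h1 | h1
    · have h2 : shrink (C.τ j) t₀ ≠ 0 := by
        rw [shrink_of_ge (C.τ_pos j) h1.le]
        have : t₀ / C.τ j < 1 := (div_lt_one (C.τ_pos j)).2 h1
        linarith
      have h3 : x = x' := by
        simpa [traj, h2] using h
      rw [h3]
    · rw [C.traj_of_le (h1.trans ht), C.traj_of_le (h1.trans ht)]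
  · have h1 := C.τ_le k
    have h2 := C.τ_le (C.p k)
    rw [C.T_p] at h2
    rw [C.traj_of_le (by linarith), C.traj_of_le (by linarith), C.center_partner (hT.trans ht)]

/-! ### The Eulerian velocity field -/

/-- The Eulerian velocity on the `k`-th blob, extended by zero. -/
noncomputable def blobField (k : ℕ) (q : ℝ × E n) : E n :=
  open Classical in
  if ‖q.2 - C.center k q.1‖ ≤ shrink (C.τ k) q.1 * C.r k then
    C.meanVel k q.1 - (if q.1 < C.τ k then 1 / (C.τ k - q.1) else 0) • (q.2 - C.center k q.1)
  else 0

/-- The point `q` of space-time is on the `k`-th blob, or on no blob. -/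
def OnBlob (q : ℝ × E n) (k : ℕ) : Prop :=
  ‖q.2 - C.center k q.1‖ ≤ shrink (C.τ k) q.1 * C.r k ∨
    ∀ j, ¬ ‖q.2 - C.center j q.1‖ ≤ shrink (C.τ j) q.1 * C.r j

lemma exists_onBlob (q : ℝ × E n) : ∃ k, C.OnBlob q k := by
  by_cases h : ∃ k, ‖q.2 - C.center k q.1‖ ≤ shrink (C.τ k) q.1 * C.r k
  · obtain ⟨k, hk⟩ := h
    exact ⟨k, Or.inl hk⟩
  · exact ⟨0, Or.inr (not_exists.1 h)⟩

open Classical in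
/-- The Eulerian velocity field. -/
noncomputable def field (q : ℝ × E n) : E n :=
  C.blobField (Nat.find (C.exists_onBlob q)) q

lemma measurable_center (k : ℕ) : Measurable (C.center k) :=
  (continuous_kinkPath _ _ _ _).measurable

lemma measurable_meanVel (k : ℕ) : Measurable (C.meanVel k) := by
  unfold meanVel
  exact measurable_const.add ((Measurable.ite measurableSet_Ici measurable_const
    measurable_const).smul_const _)

lemma measurableSet_blob (k : ℕ) : MeasurableSet
    {q : ℝ × E n | ‖q.2 - C.center k q.1‖ ≤ shrink (C.τ k) q.1 * C.r k} := by
  have h1 : Measurable fun q : ℝ × E n => C.center k q.1 :=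
    (C.measurable_center k).comp measurable_fst
  have h2 : Measurable fun q : ℝ × E n => shrink (C.τ k) q.1 :=
    (continuous_shrink (C.τ k)).measurable.comp measurable_fst
  exact measurableSet_le (measurable_snd.sub h1).norm (h2.mul_const _)

lemma measurable_blobField (k : ℕ) : Measurable (C.blobField k) := by
  have h1 : Measurable fun q : ℝ × E n => C.center k q.1 :=
    (C.measurable_center k).comp measurable_fst
  have h2 : Measurable fun q : ℝ × E n => C.meanVel k q.1 :=
    (C.measurable_meanVel k).comp measurable_fst
  have h3 : Measurable fun q : ℝ × E n => q.2 - C.center k q.1 := measurable_snd.sub h1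
  have h4 : Measurable fun q : ℝ × E n => if q.1 < C.τ k then 1 / (C.τ k - q.1) else 0 :=
    Measurable.ite (measurable_fst measurableSet_Iio) (by fun_prop) measurable_const
  exact Measurable.ite (C.measurableSet_blob k) (h2.sub (h4.smul h3)) measurable_const

lemma measurable_field : Measurable C.field := by
  classical
  refine Measurable.find C.measurable_blobField (fun k => ?_) C.exists_onBlob
  refine (C.measurableSet_blob k).union ?_
  have : {q : ℝ × E n | ∀ j, ¬ ‖q.2 - C.center j q.1‖ ≤ shrink (C.τ j) q.1 * C.r j} =
      ⋂ j, {q : ℝ × E n | ‖q.2 - C.center j q.1‖ ≤ shrink (C.τ j) q.1 * C.r j}ᶜ := by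
    ext; simp
  refine MeasurableSet.congr ?_ this.symm
  exact MeasurableSet.iInter fun j => (C.measurableSet_blob j).compl

lemma norm_field_le (q : ℝ × E n) : ‖C.field q‖ ≤ 2 * C.M := by
  classical
  have hM := C.M_nonneg
  unfold field
  generalize Nat.find (C.exists_onBlob q) = k
  unfold blobField
  split_ifs with h h1
  · have hp : 0 < C.τ k - q.1 := by linarith
    rw [shrink_of_ge (C.τ_pos k) h1.le] at h
    have h2 : (1 - q.1 / C.τ k) * C.r k ≤ (C.τ k - q.1) * C.M := by
      have : (1 - q.1 / C.τ k) = (C.τ k - q.1) / C.τ k := by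
        have := (C.τ_pos k).ne'
        field_simp
      rw [this, div_mul_eq_mul_div, div_le_iff₀ (C.τ_pos k), mul_assoc]
      exact mul_le_mul_of_nonneg_left (C.r_le k) hp.le
    have h3 : ‖(1 / (C.τ k - q.1)) • (q.2 - C.center k q.1)‖ ≤ C.M := by
      rw [norm_smul, Real.norm_of_nonneg (by positivity), one_div_mul_eq_div, div_le_iff₀ hp,
        mul_comm C.M]
      exact h.trans h2
    calc _ ≤ _ := norm_sub_le _ _
      _ ≤ 2 * C.M := by linarith [C.norm_meanVel_le k q.1]
  · simp only [zero_smul, sub_zero]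
    linarith [C.norm_meanVel_le k q.1]
  · simpa using hM

lemma field_traj {k : ℕ} {x : E n} (hx : ‖x - C.c k‖ ≤ C.r k) {t : ℝ} (ht : 0 ≤ t) :
    C.field (t, C.traj k t x) = C.trajVel k t x := by
  classical
  have hk := C.norm_traj_sub_center_le hx t
  unfold field
  have hj := Nat.find_spec (C.exists_onBlob (t, C.traj k t x))
  generalize Nat.find (C.exists_onBlob (t, C.traj k t x)) = j at hj
  have hj' : ‖C.traj k t x - C.center j t‖ ≤ shrink (C.τ j) t * C.r j :=
    hj.resolve_right fun h => h k hk
  simp only [blobField, hj', if_true]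
  rcases C.sep t ht k j _ hk hj' with rfl | ⟨rfl, hT⟩
  · rcases lt_or_ge t (C.τ j) with h1 | h1
    · have hp : C.τ j - t ≠ 0 := by linarith
      have hp' := (C.τ_pos j).ne'
      rw [C.trajVel_of_lt h1, if_pos h1, C.meanVel_of_lt (h1.trans_le (C.τ_le j)), traj,
        add_sub_cancel_left, shrink_of_ge (C.τ_pos j) h1.le, smul_smul]
      congr 2
      field_simp
    · rw [C.trajVel_of_le h1, if_neg (not_lt.2 h1), zero_smul, sub_zero]
  · have h1 := C.τ_le k
    have h2 := C.τ_le (C.p k)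
    rw [C.T_p] at h2
    rw [C.trajVel_of_le (by linarith), if_neg (by linarith), zero_smul, sub_zero,
      C.meanVel_of_le hT, C.meanVel_of_le (by rwa [C.T_p]), C.W_p]

end Clustering

lemma memLp_two_of_bounded {α F : Type*} [MeasurableSpace α] {μ : Measure α} [IsFiniteMeasure μ]
    [NormedAddCommGroup F] {f : α → F} (hf : AEStronglyMeasurable f μ) {M : ℝ}
    (h : ∀ a, ‖f a‖ ≤ M) (p : ENNReal) : MemLp f p μ :=
  MemLp.of_bound hf M (Filter.Eventually.of_forall h)

lemma measurable_apply_nat {α β : Type*} [MeasurableSpace α] [MeasurableSpace β]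
    {F : ℕ → α → β} (hF : ∀ k, Measurable (F k)) {κ : α → ℕ} (hκ : Measurable κ) :
    Measurable fun a => F (κ a) a := by
  have h1 : Measurable fun q : ℕ × α => F q.1 q.2 := measurable_from_prod_countable_right hF
  exact h1.comp (hκ.prodMk measurable_id)

/-- A vector `f` with `f - g` orthogonal to `f` has smaller norm than `g`. -/
lemma eLpNorm_two_le_of_integral_sub_mul {α : Type*} [MeasurableSpace α] {μ : Measure α}
    {f g : α → ℝ} (hf : MemLp f 2 μ) (hg : MemLp g 2 μ) (h : ∫ a, (f a - g a) * f a ∂μ = 0) :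
    eLpNorm f 2 μ ≤ eLpNorm g 2 μ := by
  have h1 : ∫ a, f a ^ 2 ∂μ ≤ ∫ a, g a ^ 2 ∂μ := by
    have i1 : Integrable (fun a => g a ^ 2) μ := hg.integrable_sq
    have i2 : Integrable (fun a => f a ^ 2) μ := hf.integrable_sq
    have i3 : Integrable (fun a => (f a - g a) ^ 2) μ := (hf.sub hg).integrable_sq
    have i4 : Integrable (fun a => (f a - g a) * f a) μ := (hf.sub hg).integrable_mul hf
    have h2 : ∫ a, g a ^ 2 ∂μ = ∫ a, f a ^ 2 ∂μ + ∫ a, (f a - g a) ^ 2 ∂μ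
        - 2 * ∫ a, (f a - g a) * f a ∂μ := by
      have i5 : Integrable (fun a => f a ^ 2 + (f a - g a) ^ 2) μ := i2.add i3
      rw [← integral_const_mul, ← integral_add i2 i3, ← integral_sub i5 (i4.const_mul 2)]
      exact integral_congr_ae (Filter.Eventually.of_forall fun a => by ring)
    have h3 : 0 ≤ ∫ a, (f a - g a) ^ 2 ∂μ := integral_nonneg fun a => sq_nonneg _
    rw [h2, h]
    linarith
  rw [hf.eLpNorm_eq_integral_rpow_norm (by simp) (by simp),
    hg.eLpNorm_eq_integral_rpow_norm (by simp) (by simp)]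
  simp only [ENNReal.toReal_ofNat, Real.rpow_ofNat, Real.norm_eq_abs, sq_abs]
  gcongr

/-- Compactly supported smooth functions are dense in the pull-back of `L²` along a map. -/
lemma exists_contDiff_eLpNorm_comp_sub_lt {α F : Type*} [MeasurableSpace α] {μ : Measure α}
    [IsFiniteMeasure μ] [NormedAddCommGroup F] [NormedSpace ℝ F] [FiniteDimensional ℝ F]
    [MeasurableSpace F] [BorelSpace F] {X : α → F} (hX : AEMeasurable X μ) {v : F → ℝ}
    (hv : Measurable v) {M : ℝ} (hM : ∀ x, ‖v x‖ ≤ M) {ε : ENNReal} (hε : 0 < ε) :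
    ∃ θ : F → ℝ, ContDiff ℝ 1 θ ∧ HasCompactSupport θ ∧
      eLpNorm (fun a => v (X a) - θ (X a)) 2 μ < ε := by
  obtain ⟨δ, hδ, hδε⟩ := ENNReal.lt_iff_exists_nnreal_btwn.1 hε
  have hδ' : (0 : ℝ) < δ := by exact_mod_cast hδ
  have h1 : MemLp v 2 (μ.map X) := memLp_two_of_bounded hv.aestronglyMeasurable hM 2
  obtain ⟨θ, h2, h3, h4⟩ := h1.exist_eLpNorm_sub_le (by simp) (by simp) hδ'
  refine ⟨θ, h3.of_le (by exact_mod_cast le_top), h2, lt_of_le_of_lt ?_ hδε⟩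
  have h5 := eLpNorm_map_measure (p := 2)
    ((hv.sub h3.continuous.measurable).aestronglyMeasurable (μ := μ.map X)) hX
  rw [h5] at h4
  simpa [Function.comp_def] using h4

lemma MemJAt.memLp {D : Set (E n)} {X : ℝ → E n → E n} {t : ℝ} {φ : E n → ℝ}
    [IsFiniteMeasure (volume.restrict D)]
    (hφ : MemJAt D X t φ) (hX : AEMeasurable (X t) (volume.restrict D)) :
    MemLp (fun y => φ (X t y)) 2 (volume.restrict D) := by
  obtain ⟨θ, h1, h2, h3⟩ := hφ.2 1 one_pos
  obtain ⟨M, hM⟩ := h2.exists_bound_of_continuous h1.continuous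
  have m1 : AEStronglyMeasurable (fun y => θ (X t y)) (volume.restrict D) :=
    (h1.continuous.measurable.comp_aemeasurable hX).aestronglyMeasurable
  have m2 : AEStronglyMeasurable (fun y => φ (X t y)) (volume.restrict D) :=
    (hφ.1.comp_aemeasurable hX).aestronglyMeasurable
  have h4 : MemLp (fun y => θ (X t y)) 2 (volume.restrict D) :=
    memLp_two_of_bounded m1 (fun y => hM _) 2
  have h5 : MemLp (fun y => φ (X t y) - θ (X t y)) 2 (volume.restrict D) :=
    ⟨m2.sub m1, h3.trans ENNReal.one_lt_top⟩
  refine (h5.add h4).ae_eq (Filter.Eventually.of_forall fun y => ?_)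
  simp

/-- Lagrangian coordinates `y ∈ D` for the blobs of `C`: `y` stands for the point `f y` of the blob
with index `κ y`. -/
structure IsLabelling (C : Clustering n) (D : Set (E n)) (f : E n → E n) (κ : E n → ℕ) :
    Prop where
  isOpen : IsOpen D
  volume_eq : volume D = 1
  measurable_f : Measurable f
  measurable_κ : Measurable κ
  mem : ∀ y, ‖f y - C.c (κ y)‖ ≤ C.r (κ y)
  mass : ∀ k, (volume.restrict D).real (κ ⁻¹' {k}) = C.m k
  barycenter : ∀ k, ∫ y in κ ⁻¹' {k}, (f y - C.c k) ∂(volume.restrict D) = 0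

namespace Clustering

variable (C : Clustering n)

/-- The flow of `C` in Lagrangian coordinates. -/
noncomputable def flow (f : E n → E n) (κ : E n → ℕ) (t : ℝ) (y : E n) : E n :=
  C.traj (κ y) t (f y)

noncomputable def flowVel (f : E n → E n) (κ : E n → ℕ) (t : ℝ) (y : E n) : E n :=
  C.trajVel (κ y) t (f y)

lemma fwdDeriv_flow (f : E n → E n) (κ : E n → ℕ) (t : ℝ) (y : E n) :
    fwdDeriv (C.flow f κ) t y = C.flowVel f κ t y :=
  (C.hasDerivWithinAt_traj (κ y) t (f y)).derivWithin (uniqueDiffWithinAt_Ici t)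

variable {C} {D : Set (E n)} {f : E n → E n} {κ : E n → ℕ}

lemma measurable_uncurry_flow (h : IsLabelling C D f κ) :
    Measurable fun q : ℝ × E n => C.flow f κ q.1 q.2 := by
  have h1 : ∀ k, Measurable fun q : ℝ × E n => C.traj k q.1 (f q.2) := fun k => by
    have h2 : Continuous fun q : ℝ × E n => C.traj k q.1 q.2 := by
      unfold traj center; fun_prop
    exact h2.measurable.comp (measurable_fst.prodMk (h.measurable_f.comp measurable_snd))
  exact measurable_apply_nat h1 (h.measurable_κ.comp measurable_snd)

lemma measurable_flow (h : IsLabelling C D f κ) (t : ℝ) : Measurable (C.flow f κ t) := by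
  have h1 : ∀ k, Measurable fun y : E n => C.traj k t (f y) := fun k => by
    have h2 : Continuous fun x : E n => C.traj k t x := by
      unfold traj center; fun_prop
    exact h2.measurable.comp h.measurable_f
  exact measurable_apply_nat h1 h.measurable_κ

lemma measurable_flowVel (h : IsLabelling C D f κ) (t : ℝ) : Measurable (C.flowVel f κ t) := by
  have h1 : ∀ k, Measurable fun y : E n => C.trajVel k t (f y) := fun k => by
    have h2 : Continuous fun x : E n => C.trajVel k t x := by
      unfold trajVel; fun_prop
    exact h2.measurable.comp h.measurable_f
  exact measurable_apply_nat h1 h.measurable_κ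

lemma field_flow (h : IsLabelling C D f κ) {t : ℝ} (ht : 0 ≤ t) (y : E n) :
    C.field (t, C.flow f κ t y) = C.flowVel f κ t y :=
  C.field_traj (h.mem y) ht

lemma norm_flowVel_le (h : IsLabelling C D f κ) (t : ℝ) (y : E n) :
    ‖C.flowVel f κ t y‖ ≤ 2 * C.M :=
  C.norm_trajVel_le (h.mem y) t

lemma isProbabilityMeasure_restrict (h : IsLabelling C D f κ) :
    IsProbabilityMeasure (volume.restrict D) :=
  ⟨by simp [h.volume_eq]⟩

lemma isFlow (h : IsLabelling C D f κ) (T : ℝ) : IsFlow T D (C.flow f κ) where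
  isOpen_domain := h.isOpen
  volume_domain := h.volume_eq
  aemeasurable t _ := (measurable_flow h t).aemeasurable
  continuousOn y _ := (C.continuous_traj (κ y) (f y)).continuousOn
  hasFwdDeriv y _ t _ := (C.hasDerivWithinAt_traj (κ y) t (f y)).differentiableWithinAt
  energy_bound := by
    have := isProbabilityMeasure_restrict h
    refine lt_of_le_of_lt (b := ENNReal.ofReal (2 * C.M) ^ 2) ?_ (by finiteness)
    refine iSup₂_le fun t _ => ?_
    calc ∫⁻ y in D, ‖fwdDeriv (C.flow f κ) t y‖ₑ ^ 2
        ≤ ∫⁻ y in D, ENNReal.ofReal (2 * C.M) ^ 2 := by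
          refine lintegral_mono fun y => ?_
          rw [fwdDeriv_flow, ← ofReal_norm]
          have := norm_flowVel_le h t y
          gcongr
      _ = _ := by simp

lemma setIntegral_flowVel (h : IsLabelling C D f κ) (t : ℝ) (φ : E n → ℝ) (k : ℕ) :
    ∫ y in κ ⁻¹' {k}, φ (C.flow f κ t y) • (C.flowVel f κ t y - C.flowVel f κ 0 y)
        ∂(volume.restrict D) =
      φ (C.center k t) • C.m k • (C.meanVel k t - C.w k) := by
  have := isProbabilityMeasure_restrict h
  have hmeas : MeasurableSet (κ ⁻¹' {k}) := h.measurable_κ (measurableSet_singleton k)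
  rcases lt_or_ge t (C.τ k) with ht | ht
  · rw [C.meanVel_of_lt (ht.trans_le (C.τ_le k)), sub_self, smul_zero, smul_zero]
    refine setIntegral_eq_zero_of_forall_eq_zero fun y hy => ?_
    have hy : κ y = k := hy
    rw [flowVel, flowVel, hy, C.trajVel_of_lt ht, C.trajVel_of_lt (C.τ_pos k), sub_self, smul_zero]
  · have h1 : ∀ y ∈ κ ⁻¹' {k}, φ (C.flow f κ t y) • (C.flowVel f κ t y - C.flowVel f κ 0 y) =
        φ (C.center k t) • ((C.meanVel k t - C.w k) + (1 / C.τ k) • (f y - C.c k)) := by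
      intro y hy
      have hy : κ y = k := hy
      rw [flowVel, flowVel, flow, hy, C.traj_of_le ht, C.trajVel_of_le ht,
        C.trajVel_of_lt (C.τ_pos k)]
      congr 1
      abel
    have hi : IntegrableOn (fun y => f y - C.c k) (κ ⁻¹' {k}) (volume.restrict D) := by
      refine Measure.integrableOn_of_bounded (measure_ne_top _ _)
        (h.measurable_f.sub_const _).aestronglyMeasurable (M := C.r k) ?_
      filter_upwards [ae_restrict_mem hmeas] with y hy
      have hy : κ y = k := hy
      exact hy ▸ h.mem y
    have hi' : IntegrableOn (fun y => (1 / C.τ k) • (f y - C.c k)) (κ ⁻¹' {k})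
        (volume.restrict D) := hi.smul (1 / C.τ k)
    rw [setIntegral_congr_fun hmeas h1, integral_smul, integral_add (integrable_const _) hi',
      integral_smul, h.barycenter, smul_zero, add_zero, setIntegral_const,
      h.mass]

lemma integrable_smul_flowVel_sub (h : IsLabelling C D f κ) (t : ℝ) {φ : E n → ℝ}
    (hφ : MemJAt D (C.flow f κ) t φ) :
    Integrable (fun y => φ (C.flow f κ t y) • (C.flowVel f κ t y - C.flowVel f κ 0 y))
      (volume.restrict D) := by
  have := isProbabilityMeasure_restrict h
  refine ((hφ.memLp (measurable_flow h t).aemeasurable).integrable one_le_two).smul_bdd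
    (2 * C.M + 2 * C.M)
    ((measurable_flowVel h t).sub (measurable_flowVel h 0)).aestronglyMeasurable ?_
  refine Filter.Eventually.of_forall fun y => (norm_sub_le _ _).trans ?_
  exact add_le_add (norm_flowVel_le h t y) (norm_flowVel_le h 0 y)

/-- The change of velocity is orthogonal to all functions of the current position. -/
lemma integral_smul_flowVel_sub (h : IsLabelling C D f κ) (t : ℝ) {φ : E n → ℝ}
    (hφ : MemJAt D (C.flow f κ) t φ) :
    ∫ y in D, φ (C.flow f κ t y) • (C.flowVel f κ t y - C.flowVel f κ 0 y) = 0 := by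
  have := isProbabilityMeasure_restrict h
  have hmeas : ∀ k, MeasurableSet (κ ⁻¹' {k}) := fun k =>
    h.measurable_κ (measurableSet_singleton k)
  have hint := integrable_smul_flowVel_sub h t hφ
  have hU : (⋃ k, κ ⁻¹' {k}) = univ := by ext; simp
  have hs := hasSum_integral_iUnion hmeas
    (fun i j hij => Set.disjoint_left.2 fun y hi hj => hij (by
      have hi : κ y = i := hi
      have hj : κ y = j := hj
      rw [← hi, hj])) (hint.integrableOn (s := ⋃ k, κ ⁻¹' {k}))
  rw [hU, setIntegral_univ] at hs
  simp only [setIntegral_flowVel h t φ] at hs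
  have hs' := (Equiv.hasSum_iff (Function.Involutive.toPerm C.p C.p_p)).2 hs
  have h0 := hs.add hs'
  have hz : ∀ k, φ (C.center k t) • C.m k • (C.meanVel k t - C.w k) +
      φ (C.center (C.p k) t) • C.m (C.p k) • (C.meanVel (C.p k) t - C.w (C.p k)) = 0 := by
    intro k
    rcases lt_or_ge t (C.T k) with ht | ht
    · simp [C.meanVel_of_lt ht, C.meanVel_of_lt (k := C.p k) (by rwa [C.T_p])]
    · rw [C.center_partner ht, C.meanVel_of_le ht, C.meanVel_of_le (k := C.p k) (by rwa [C.T_p]),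
        ← smul_add, smul_sub, smul_sub, sub_add_sub_comm, C.balance, sub_self, smul_zero]
  have h2 := (hasSum_zero.congr_fun hz).unique h0
  rw [← two_smul ℝ] at h2
  exact (smul_eq_zero.1 h2.symm).resolve_left two_ne_zero

lemma memJ_field (h : IsLabelling C D f κ) (T : ℝ) (i : Fin n) :
    MemJ T D (C.flow f κ) (fun t x => C.field (t, x) i) := by
  have := isProbabilityMeasure_restrict h
  have hm : Measurable fun q : ℝ × E n => C.field q i := by
    have : Continuous fun x : E n => x i := by fun_prop
    exact this.measurable.comp C.measurable_field
  refine ⟨hm, fun ε hε => ?_⟩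
  have : IsFiniteMeasure (slab T D) := by unfold slab; infer_instance
  exact exists_contDiff_eLpNorm_comp_sub_lt
    (measurable_fst.prodMk (measurable_uncurry_flow h)).aemeasurable hm
    (fun q => (PiLp.norm_apply_le _ i).trans (C.norm_field_le q)) hε

lemma memJAt_field (h : IsLabelling C D f κ) (t : ℝ) (i : Fin n) :
    MemJAt D (C.flow f κ) t (fun x => C.field (t, x) i) := by
  have := isProbabilityMeasure_restrict h
  have hm : Measurable fun x : E n => C.field (t, x) i := by
    have : Continuous fun x : E n => x i := by fun_prop
    exact this.measurable.comp (C.measurable_field.comp measurable_prodMk_left)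
  exact ⟨hm, fun ε hε => exists_contDiff_eLpNorm_comp_sub_lt
    (measurable_flow h t).aemeasurable hm
    (fun q => (PiLp.norm_apply_le _ i).trans (C.norm_field_le _)) hε⟩

lemma isW_field (h : IsLabelling C D f κ) (T : ℝ) (i : Fin n) :
    IsW T D (C.flow f κ) (fun y => fwdDeriv (C.flow f κ) 0 y i)
      (fun t x => C.field (t, x) i) := by
  have := isProbabilityMeasure_restrict h
  have hc : Continuous fun x : E n => x i := by fun_prop
  have hmem : ∀ t, MemLp (fun y => C.flowVel f κ t y i) 2 (volume.restrict D) := fun t =>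
    memLp_two_of_bounded (hc.measurable.comp (measurable_flowVel h t)).aestronglyMeasurable
      (fun y => (PiLp.norm_apply_le _ i).trans (norm_flowVel_le h t y)) 2
  have horth : ∀ t, 0 ≤ t → ∀ φ : E n → ℝ, MemJAt D (C.flow f κ) t φ →
      ∫ y in D, (C.field (t, C.flow f κ t y) i - fwdDeriv (C.flow f κ) 0 y i) *
        φ (C.flow f κ t y) = 0 := by
    intro t ht φ hφ
    have h1 := congrArg (fun x : E n => x i) (integral_smul_flowVel_sub h t hφ)
    have hint : Integrable (fun y => φ (C.flow f κ t y) •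
        (C.flowVel f κ t y - C.flowVel f κ 0 y)) (volume.restrict D) :=
      integrable_smul_flowVel_sub h t hφ
    have h2 := (EuclideanSpace.proj (𝕜 := ℝ) i).integral_comp_comm hint
    simp only [field_flow h ht, fwdDeriv_flow]
    refine Eq.trans ?_ (h2.trans h1)
    refine integral_congr_ae (Filter.Eventually.of_forall fun y => ?_)
    simp [mul_comm]
  refine ⟨?_, memJ_field h T i, fun t _ => memJAt_field h t i, fun t ht => ?_,
    fun t ht => horth t ht.1⟩
  · simp only [fwdDeriv_flow]
    exact hmem 0
  · have h1 := horth t ht.1 _ (memJAt_field h t i)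
    simp only [field_flow h ht.1, fwdDeriv_flow] at h1 ⊢
    exact eLpNorm_two_le_of_integral_sub_mul (hmem t) (hmem 0) h1

/-- The flow of a clustering is a sticky weak solution. -/
theorem isStickyWeakSolution (h : IsLabelling C D f κ) {μ : Measure (E n)}
    (hμ : (volume.restrict D).map f = μ) {v₀ : E n → E n}
    (hv : ∀ y, v₀ (f y) = C.w (κ y) - (1 / C.τ (κ y)) • (f y - C.c (κ y)))
    (hvm : Measurable v₀) (T : ℝ) : IsStickyWeakSolution T μ v₀ D (C.flow f κ) where
  isFlow := isFlow h T
  weak := by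
    refine ⟨fun t x => C.field (t, x), isW_field h T, ?_⟩
    have := isProbabilityMeasure_restrict h
    have h1 : ∀ᵐ p : ℝ × E n ∂(slab T D), p.1 ∈ Icc 0 T :=
      Measure.quasiMeasurePreserving_fst.ae (ae_restrict_mem measurableSet_Icc)
    filter_upwards [h1] with p hp
    rw [field_flow h hp.1, fwdDeriv_flow]
  initial_mass φ hφ := by
    simp only [flow, C.traj_zero]
    rw [← hμ, integral_map h.measurable_f.aemeasurable hφ.1.aestronglyMeasurable]
  initial_momentum φ hφ := by
    simp only [flow, C.traj_zero, fwdDeriv_flow, flowVel, C.trajVel_zero]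
    have hm : Measurable fun x => φ x • v₀ x := hφ.1.smul hvm
    rw [← hμ, integral_map h.measurable_f.aemeasurable hm.aestronglyMeasurable]
    refine integral_congr_ae (Filter.Eventually.of_forall fun y => ?_)
    simp only [hv]
  sticky y₁ _ y₂ _ t₀ ht₀ heq t ht := C.traj_sticky (h.mem y₁) (h.mem y₂) ht₀.1 ht.1 heq

end Clustering

/-- The dyadic scales. -/
noncomputable def scale (k : ℕ) : ℝ := (1 / 2) ^ k

lemma scale_pos (k : ℕ) : 0 < scale k := by unfold scale; positivity

lemma scale_succ (k : ℕ) : scale (k + 1) = scale k / 2 := by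
  unfold scale; rw [pow_succ]; ring

lemma scale_anti {j k : ℕ} (h : j ≤ k) : scale k ≤ scale j :=
  pow_le_pow_of_le_one (by norm_num) (by norm_num) h

lemma scale_le_one (k : ℕ) : scale k ≤ 1 := pow_le_one₀ (by norm_num) (by norm_num)

/-- The coordinate functions of the particle trajectories: those with parameters `s ≠ s'`
meet at the time `s + s'`. -/
def parab (s t : ℝ) : ℝ := s ^ 2 - s * t

/-- The first or second coordinate direction, according to the parity of `k`. -/
def axis (hn : 2 ≤ n) (k : ℕ) : Fin n := ⟨k % 2, by omega⟩

lemma axis_succ_ne (hn : 2 ≤ n) (k : ℕ) : axis hn (k + 1) ≠ axis hn k := by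
  simp only [axis, ne_eq, Fin.mk.injEq]; omega

lemma axis_congr (hn : 2 ≤ n) {j k : ℕ} (h : j % 2 = k % 2) : axis hn j = axis hn k := by
  simp only [axis, h]

/-- Initial position of the `k`-th particle. -/
noncomputable def pos (hn : 2 ≤ n) (k : ℕ) : E n :=
  EuclideanSpace.single (axis hn k) (scale (k + 1) ^ 2) +
    EuclideanSpace.single (axis hn (k + 1)) (scale (k + 2) ^ 2)

/-- Initial velocity of the `k`-th particle. -/
noncomputable def vel (hn : 2 ≤ n) (k : ℕ) : E n :=
  -(EuclideanSpace.single (axis hn k) (scale (k + 1)) +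
    EuclideanSpace.single (axis hn (k + 1)) (scale (k + 2)))

lemma free_axis (hn : 2 ≤ n) (k : ℕ) (t : ℝ) :
    (pos hn k + t • vel hn k) (axis hn k) = parab (scale (k + 1)) t := by
  have := (axis_succ_ne hn k).symm
  simp [pos, vel, parab, this]; ring

lemma free_axis_succ (hn : 2 ≤ n) (k : ℕ) (t : ℝ) :
    (pos hn k + t • vel hn k) (axis hn (k + 1)) = parab (scale (k + 2)) t := by
  have := axis_succ_ne hn k
  simp [pos, vel, parab, this]; ring

lemma free_apply_of_ne (hn : 2 ≤ n) {k : ℕ} (t : ℝ) {i : Fin n} (h : i ≠ axis hn k)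
    (h' : i ≠ axis hn (k + 1)) : (pos hn k + t • vel hn k) i = 0 := by
  simp [pos, vel, h, h']

lemma norm_vel_le (hn : 2 ≤ n) (k : ℕ) : ‖vel hn k‖ ≤ 2 * scale k := by
  rw [vel, norm_neg]
  refine (norm_add_le _ _).trans ?_
  rw [PiLp.norm_single, PiLp.norm_single, Real.norm_of_nonneg (scale_pos _).le,
    Real.norm_of_nonneg (scale_pos _).le, scale_succ (k + 1), scale_succ k]
  linarith [scale_pos k]

lemma norm_pos_le (hn : 2 ≤ n) (k : ℕ) : ‖pos hn k‖ ≤ 2 := by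
  rw [pos]
  refine (norm_add_le _ _).trans ?_
  have h1 := pow_le_one₀ (n := 2) (scale_pos (k + 1)).le (scale_le_one _)
  have h2 := pow_le_one₀ (n := 2) (scale_pos (k + 2)).le (scale_le_one _)
  rw [PiLp.norm_single, PiLp.norm_single, Real.norm_of_nonneg (sq_nonneg _),
    Real.norm_of_nonneg (sq_nonneg _)]
  linarith

/-- The partner of the particle `k`: the particles are paired as `{0,1}, {2,3}, …` for `e = 0`, and
as `{0}, {1,2}, {3,4}, …` for `e = 1`. -/
def partner (e k : ℕ) : ℕ := if (k + e) % 2 = 0 then k + 1 else k - 1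

/-- The index `K` of the cluster `{K - 1, K}` which contains the particle `k`. -/
def clusterIndex (e k : ℕ) : ℕ := if (k + e) % 2 = 0 then k + 1 else k

/-- The scale in the coordinate which the particle `k` does not share with its partner. -/
noncomputable def ownScale (e k : ℕ) : ℝ :=
  if (k + e) % 2 = 0 then scale (clusterIndex e k) else scale (clusterIndex e k + 2)

/-- The time at which the particle `k` meets its partner. -/
noncomputable def meetTime (e k : ℕ) : ℝ :=
  scale (clusterIndex e k) + scale (clusterIndex e k + 2)

lemma partner_partner {e : ℕ} (he : e ≤ 1) (k : ℕ) : partner e (partner e k) = k := by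
  unfold partner; split_ifs <;> omega

lemma clusterIndex_partner {e : ℕ} (he : e ≤ 1) (k : ℕ) :
    clusterIndex e (partner e k) = clusterIndex e k := by
  unfold clusterIndex partner; split_ifs <;> omega

lemma clusterIndex_parity (e k : ℕ) : (clusterIndex e k + e) % 2 = 1 := by
  unfold clusterIndex; split_ifs <;> omega

lemma clusterIndex_le (e k : ℕ) : clusterIndex e k ≤ k + 1 := by
  unfold clusterIndex; split_ifs <;> omega

lemma eq_or_eq_partner {e j k : ℕ} (h : clusterIndex e j = clusterIndex e k) :
    j = k ∨ j = partner e k := by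
  unfold clusterIndex at h; unfold partner; split_ifs at h ⊢ <;> omega

/-- Either `k` is alone in its cluster, or the own scales of `k` and its partner are the two
scales of the cluster. -/
lemma ownScale_cases {e : ℕ} (he : e ≤ 1) (k : ℕ) :
    (clusterIndex e k = 0 ∧ partner e k = k) ∨
    (ownScale e k = scale (clusterIndex e k) ∧
      ownScale e (partner e k) = scale (clusterIndex e k + 2)) ∨
    (ownScale e k = scale (clusterIndex e k + 2) ∧
      ownScale e (partner e k) = scale (clusterIndex e k)) := by
  unfold ownScale
  rw [clusterIndex_partner he]
  by_cases h : (k + e) % 2 = 0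
  · have h1 : ¬ (partner e k + e) % 2 = 0 := by unfold partner; split_ifs; omega
    simp [h, h1]
  · rcases Nat.eq_zero_or_pos k with rfl | hk
    · left
      exact ⟨if_neg h, if_neg h⟩
    · have h1 : (partner e k + e) % 2 = 0 := by unfold partner; split_ifs; omega
      simp [h, h1]

lemma clusterIndex_of_even {e k : ℕ} (h : (k + e) % 2 = 0) : clusterIndex e k = k + 1 := if_pos h

lemma clusterIndex_of_odd {e k : ℕ} (h : ¬ (k + e) % 2 = 0) : clusterIndex e k = k := if_neg h

lemma axis_add_two (hn : 2 ≤ n) (k : ℕ) : axis hn (k + 1 + 1) = axis hn k :=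
  axis_congr hn (by omega)

lemma free_shared (hn : 2 ≤ n) (e k : ℕ) (t : ℝ) :
    (pos hn k + t • vel hn k) (axis hn (clusterIndex e k)) =
      parab (scale (clusterIndex e k + 1)) t := by
  by_cases h : (k + e) % 2 = 0
  · rw [clusterIndex_of_even h]
    exact free_axis_succ hn k t
  · rw [clusterIndex_of_odd h]
    exact free_axis hn k t

lemma free_own (hn : 2 ≤ n) (e k : ℕ) (t : ℝ) :
    (pos hn k + t • vel hn k) (axis hn (clusterIndex e k + 1)) = parab (ownScale e k) t := by
  by_cases h : (k + e) % 2 = 0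
  · rw [ownScale, if_pos h, clusterIndex_of_even h, axis_add_two]
    exact free_axis hn k t
  · rw [ownScale, if_neg h, clusterIndex_of_odd h]
    exact free_axis_succ hn k t

/-- The mean velocity of the cluster of the particle `k` for the masses `m`. -/
noncomputable def clusterVel (hn : 2 ≤ n) (m : ℕ → ℝ) (e k : ℕ) : E n :=
  (1 / (m k + m (partner e k))) •
    (m k • vel hn k + m (partner e k) • vel hn (partner e k))

lemma free_meet (hn : 2 ≤ n) {e : ℕ} (he : e ≤ 1) (k : ℕ) :
    pos hn k + meetTime e k • vel hn k =
      pos hn (partner e k) + meetTime e k • vel hn (partner e k) := by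
  have hK := clusterIndex_partner he k
  ext i
  by_cases h1 : i = axis hn (clusterIndex e k)
  · subst h1
    rw [free_shared, ← hK, free_shared]
  by_cases h2 : i = axis hn (clusterIndex e k + 1)
  · subst h2
    rw [free_own, ← hK, free_own]
    rcases ownScale_cases he k with ⟨-, h⟩ | ⟨h, h'⟩ | ⟨h, h'⟩
    · rw [h]
    all_goals rw [h, h', meetTime, parab, parab]; ring
  · have h3 : ∀ j, clusterIndex e j = clusterIndex e k → i ≠ axis hn j ∧ i ≠ axis hn (j + 1) := by
      intro j hj
      rw [← hj] at h1 h2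
      by_cases h : (j + e) % 2 = 0
      · rw [clusterIndex_of_even h] at h1 h2
        rw [axis_add_two] at h2
        exact ⟨h2, h1⟩
      · rw [clusterIndex_of_odd h] at h1 h2
        exact ⟨h1, h2⟩
    rw [free_apply_of_ne hn _ (h3 k rfl).1 (h3 k rfl).2,
      free_apply_of_ne hn _ (h3 _ hK).1 (h3 _ hK).2]

lemma center_eq_of_le (hn : 2 ≤ n) {m : ℕ → ℝ} (hm : ∀ k, 0 < m k) {e : ℕ} (he : e ≤ 1) (k : ℕ)
    {t : ℝ} (ht : meetTime e k ≤ t) :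
    kinkPath (pos hn k) (vel hn k) (clusterVel hn m e k) (meetTime e k) t =
      (m k / (m k + m (partner e k))) • (pos hn k + t • vel hn k) +
      (m (partner e k) / (m k + m (partner e k))) •
        (pos hn (partner e k) + t • vel hn (partner e k)) := by
  have h1 := free_meet hn he k
  have h2 : m k + m (partner e k) ≠ 0 := (add_pos (hm _) (hm _)).ne'
  have h3 : pos hn (partner e k) = pos hn k + meetTime e k • vel hn k -
      meetTime e k • vel hn (partner e k) := by rw [h1]; abel
  rw [kinkPath, max_eq_right (by linarith), h3, clusterVel]
  match_scalars <;> field_simp <;> ring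

lemma center_of_le (hn : 2 ≤ n) (m : ℕ → ℝ) {e : ℕ} (k : ℕ)
    {t : ℝ} (ht : t ≤ meetTime e k) :
    kinkPath (pos hn k) (vel hn k) (clusterVel hn m e k) (meetTime e k) t =
      pos hn k + t • vel hn k := by
  rw [kinkPath, max_eq_left (by linarith), zero_smul, add_zero]

lemma center_shared (hn : 2 ≤ n) {m : ℕ → ℝ} (hm : ∀ k, 0 < m k) {e : ℕ} (he : e ≤ 1) (k : ℕ)
    (t : ℝ) :
    kinkPath (pos hn k) (vel hn k) (clusterVel hn m e k) (meetTime e k) t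
      (axis hn (clusterIndex e k)) = parab (scale (clusterIndex e k + 1)) t := by
  rcases le_total t (meetTime e k) with ht | ht
  · rw [center_of_le hn m k ht, free_shared]
  · have h1 := free_shared hn e (partner e k) t
    rw [clusterIndex_partner he] at h1
    have h2 : m k + m (partner e k) ≠ 0 := (add_pos (hm _) (hm _)).ne'
    rw [center_eq_of_le hn hm he k ht, PiLp.add_apply, PiLp.smul_apply, PiLp.smul_apply, h1,
      free_shared]
    simp only [smul_eq_mul]
    field_simp

lemma center_own_mem (hn : 2 ≤ n) {m : ℕ → ℝ} (hm : ∀ k, 0 < m k) {e : ℕ} (he : e ≤ 1) {k : ℕ}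
    (hk : clusterIndex e k ≠ 0) {t : ℝ} (ht : meetTime e k < t) :
    kinkPath (pos hn k) (vel hn k) (clusterVel hn m e k) (meetTime e k) t
      (axis hn (clusterIndex e k + 1)) ∈
      Ioo (parab (scale (clusterIndex e k)) t) (parab (scale (clusterIndex e k + 2)) t) := by
  have h1 := free_own hn e (partner e k) t
  rw [clusterIndex_partner he] at h1
  have hA := hm k
  have hB := hm (partner e k)
  rw [center_eq_of_le hn hm he k ht.le, PiLp.add_apply, PiLp.smul_apply, PiLp.smul_apply, h1,
    free_own]
  have hlt : parab (scale (clusterIndex e k)) t < parab (scale (clusterIndex e k + 2)) t := by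
    have h2 : parab (scale (clusterIndex e k + 2)) t - parab (scale (clusterIndex e k)) t =
        (scale (clusterIndex e k) - scale (clusterIndex e k + 2)) * (t - meetTime e k) := by
      unfold parab meetTime; ring
    have h3 : 0 < scale (clusterIndex e k) - scale (clusterIndex e k + 2) := by
      rw [scale_succ, scale_succ]; linarith [scale_pos (clusterIndex e k)]
    have := mul_pos h3 (sub_pos.2 ht)
    linarith
  generalize m k = a at *
  generalize m (partner e k) = b at *
  have hab : 0 < a + b := by linarith
  simp only [smul_eq_mul, mem_Ioo]
  rw [div_mul_eq_mul_div, div_mul_eq_mul_div, ← add_div, lt_div_iff₀ hab, div_lt_iff₀ hab]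
  rcases ownScale_cases he k with ⟨h, -⟩ | ⟨h, h'⟩ | ⟨h, h'⟩
  · exact absurd h hk
  all_goals rw [h, h']; constructor <;> nlinarith

/-- The time at which the `k`-th blob focuses. -/
noncomputable def focusTime (k : ℕ) : ℝ := scale (k + 3)

/-- The radius of the `k`-th blob. -/
noncomputable def radius (k : ℕ) : ℝ := scale (k + 4) ^ 2

lemma radius_pos (k : ℕ) : 0 < radius k := pow_pos (scale_pos _) 2

lemma focusTime_le (e k : ℕ) : focusTime k ≤ scale (clusterIndex e k) / 4 := by
  have h : scale (k + 3) ≤ scale (clusterIndex e k + 2) :=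
    scale_anti (by linarith [clusterIndex_le e k])
  rw [scale_succ (clusterIndex e k + 1), scale_succ (clusterIndex e k)] at h
  unfold focusTime
  linarith

lemma radius_le (e k : ℕ) : radius k ≤ scale (clusterIndex e k) ^ 2 / 64 := by
  have h : scale (k + 4) ≤ scale (clusterIndex e k + 3) :=
    scale_anti (by linarith [clusterIndex_le e k])
  rw [scale_succ (clusterIndex e k + 2), scale_succ (clusterIndex e k + 1),
    scale_succ (clusterIndex e k)] at h
  have h2 := pow_le_pow_left₀ (scale_pos _).le h 2
  unfold radius
  linarith

lemma shrink_mul_radius_le (e k : ℕ) {t : ℝ} (ht : 0 ≤ t) :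
    shrink (focusTime k) t * radius k ≤ scale (clusterIndex e k) ^ 2 / 64 := by
  have h1 : shrink (focusTime k) t ≤ 1 := by
    have : 0 ≤ t / focusTime k := div_nonneg ht (scale_pos _).le
    exact max_le zero_le_one (by linarith)
  calc _ ≤ 1 * radius k := by gcongr; exact (radius_pos k).le
    _ ≤ _ := by rw [one_mul]; exact radius_le e k

lemma shrink_mul_radius_eq_zero (e k : ℕ) {t : ℝ} (ht : scale (clusterIndex e k) / 4 ≤ t) :
    shrink (focusTime k) t * radius k = 0 := by
  rw [shrink_of_le (show 0 < focusTime k from scale_pos _) ((focusTime_le e k).trans ht), zero_mul]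

lemma abs_apply_sub_le {x y z : E n} {a b : ℝ} (hx : ‖z - x‖ ≤ a) (hy : ‖z - y‖ ≤ b)
    (i : Fin n) : |x i - y i| ≤ a + b := by
  have h : ‖x - y‖ ≤ a + b := by
    have : x - y = (z - y) - (z - x) := by abel
    rw [this]
    exact (norm_sub_le _ _).trans (by linarith)
  exact (PiLp.norm_apply_le (x - y) i).trans h

/-- Blobs of different clusters do not meet. -/
lemma not_clusterIndex_lt (hn : 2 ≤ n) {m : ℕ → ℝ} (hm : ∀ k, 0 < m k) {e : ℕ} (he : e ≤ 1)
    {t : ℝ} (ht : 0 ≤ t) {j k : ℕ} {z : E n}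
    (hk : ‖z - kinkPath (pos hn k) (vel hn k) (clusterVel hn m e k) (meetTime e k) t‖ ≤
      shrink (focusTime k) t * radius k)
    (hj : ‖z - kinkPath (pos hn j) (vel hn j) (clusterVel hn m e j) (meetTime e j) t‖ ≤
      shrink (focusTime j) t * radius j) :
    ¬ clusterIndex e k < clusterIndex e j := by
  intro hlt
  have p1 := clusterIndex_parity e k
  have p2 := clusterIndex_parity e j
  have hax : axis hn (clusterIndex e j) = axis hn (clusterIndex e k) := axis_congr hn (by omega)
  have hax' : axis hn (clusterIndex e j + 1) = axis hn (clusterIndex e k + 1) :=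
    axis_congr hn (by omega)
  have c1 := center_shared hn hm he k t
  have c2 := center_shared hn hm he j t
  have hu := scale_pos (clusterIndex e j)
  have hsu : scale (clusterIndex e j) ≤ scale (clusterIndex e k) / 4 := by
    have : scale (clusterIndex e j) ≤ scale (clusterIndex e k + 2) := scale_anti (by omega)
    rw [scale_succ, scale_succ] at this
    linarith
  have hs1 := scale_succ (clusterIndex e k)
  have hs2 : scale (clusterIndex e k + 2) = scale (clusterIndex e k) / 4 := by
    rw [scale_succ, scale_succ]; ring
  have hu1 := scale_succ (clusterIndex e j)
  have hu2 : scale (clusterIndex e j + 2) = scale (clusterIndex e j) / 4 := by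
    rw [scale_succ, scale_succ]; ring
  have d1 := abs_apply_sub_le hk hj (axis hn (clusterIndex e k))
  rw [hax] at c2
  rw [c1, c2, hs1, hu1] at d1
  rcases le_or_gt t (scale (clusterIndex e k) / 4) with h1 | h1
  · have d2 := (le_abs_self _).trans d1
    have r1 := shrink_mul_radius_le e k ht
    have r2 := shrink_mul_radius_le e j ht
    generalize scale (clusterIndex e k) = s at *
    generalize scale (clusterIndex e j) = u at *
    unfold parab at d2
    nlinarith [mul_nonneg (show 0 ≤ s - u by linarith) (show 0 ≤ s / 4 - t by linarith)]
  · have d2 := abs_apply_sub_le hk hj (axis hn (clusterIndex e k + 1))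
    rw [shrink_mul_radius_eq_zero e k h1.le, shrink_mul_radius_eq_zero e j (by linarith),
      add_zero] at d1 d2
    have d3 := abs_nonpos_iff.1 d1
    have d4 := abs_nonpos_iff.1 d2
    have htime : t = (scale (clusterIndex e k) + scale (clusterIndex e j)) / 2 := by
      have h2 : (scale (clusterIndex e k) - scale (clusterIndex e j)) / 2 *
          ((scale (clusterIndex e k) + scale (clusterIndex e j)) / 2 - t) = 0 := by
        rw [← d3]; unfold parab; ring
      rcases mul_eq_zero.1 h2 with h3 | h3 <;> linarith
    have hTk : t ≤ meetTime e k := by rw [meetTime, hs2]; linarith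
    have hTj : meetTime e j < t := by rw [meetTime, hu2]; linarith
    have o1 := center_own_mem hn hm he (k := j) (by omega) hTj
    rw [hax', hu2] at o1
    rw [center_of_le hn m k hTk, free_own, sub_eq_zero] at d4
    rw [← d4] at o1
    have ho : ownScale e k = scale (clusterIndex e k) ∨
        ownScale e k = scale (clusterIndex e k) / 4 := by
      rw [← hs2]; unfold ownScale; split_ifs <;> simp
    obtain ⟨o2, o3⟩ := o1
    generalize scale (clusterIndex e k) = s at *
    generalize scale (clusterIndex e j) = u at *
    rcases ho with ho | ho
    · rw [ho, htime] at o3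
      unfold parab at o3
      nlinarith [mul_pos (show 0 < s - u / 4 by linarith) (show 0 < s / 2 - u / 4 by linarith)]
    · rw [ho, htime] at o2
      unfold parab at o2
      nlinarith [mul_nonneg (show 0 ≤ s / 4 - u by linarith) (show 0 ≤ s / 4 - u / 2 by linarith)]

/-- Partners do not meet before their meeting time. -/
lemma eq_or_partner_of_clusterIndex_eq (hn : 2 ≤ n) {m : ℕ → ℝ} {e : ℕ} (he : e ≤ 1)
    {t : ℝ} (ht : 0 ≤ t) {j k : ℕ} {z : E n}
    (hk : ‖z - kinkPath (pos hn k) (vel hn k) (clusterVel hn m e k) (meetTime e k) t‖ ≤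
      shrink (focusTime k) t * radius k)
    (hj : ‖z - kinkPath (pos hn j) (vel hn j) (clusterVel hn m e j) (meetTime e j) t‖ ≤
      shrink (focusTime j) t * radius j)
    (h : clusterIndex e j = clusterIndex e k) :
    j = k ∨ (j = partner e k ∧ meetTime e k ≤ t) := by
  rcases eq_or_eq_partner h with rfl | rfl
  · exact Or.inl rfl
  by_cases hT : meetTime e k ≤ t
  · exact Or.inr ⟨rfl, hT⟩
  rw [not_le] at hT
  have hTj : meetTime e (partner e k) = meetTime e k := by rw [meetTime, meetTime, h]
  have d := abs_apply_sub_le hk hj (axis hn (clusterIndex e k + 1))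
  have o := free_own hn e (partner e k) t
  rw [h] at o
  rw [center_of_le hn m k hT.le, center_of_le hn m _ (hTj ▸ hT.le), free_own, o] at d
  have hs2 : scale (clusterIndex e k + 2) = scale (clusterIndex e k) / 4 := by
    rw [scale_succ, scale_succ]; ring
  have hs := scale_pos (clusterIndex e k)
  have key : |parab (scale (clusterIndex e k)) t - parab (scale (clusterIndex e k + 2)) t| ≤
      shrink (focusTime k) t * radius k +
        shrink (focusTime (partner e k)) t * radius (partner e k) → False := by
    intro d
    rw [meetTime, hs2] at hT
    rw [hs2] at d
    have d2 := (le_abs_self _).trans d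
    rcases le_or_gt t (scale (clusterIndex e k) / 4) with h1 | h1
    · have r1 := shrink_mul_radius_le e k ht
      have r2 := shrink_mul_radius_le e (partner e k) ht
      rw [h] at r2
      generalize scale (clusterIndex e k) = s at *
      unfold parab at d2
      nlinarith
    · rw [shrink_mul_radius_eq_zero e k h1.le,
        shrink_mul_radius_eq_zero e (partner e k) (by rw [h]; exact h1.le)] at d2
      generalize scale (clusterIndex e k) = s at *
      unfold parab at d2
      nlinarith
  rcases ownScale_cases he k with ⟨-, h1⟩ | ⟨h1, h2⟩ | ⟨h1, h2⟩
  · exact Or.inl h1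
  · rw [h1, h2] at d
    exact (key d).elim
  · rw [h1, h2, abs_sub_comm] at d
    exact (key d).elim

/-- The pairs of blobs with masses `m`, for the pairing given by `e`. -/
noncomputable def pairing (hn : 2 ≤ n) (m : ℕ → ℝ) (hm : ∀ k, 0 < m k) (e : ℕ) (he : e ≤ 1) :
    Clustering n where
  c := pos hn
  w := vel hn
  W := clusterVel hn m e
  r := radius
  τ := focusTime
  T := meetTime e
  m := m
  p := partner e
  M := 2
  τ_pos k := scale_pos _
  τ_le k := by
    have h1 := focusTime_le e k
    have h2 := scale_pos (clusterIndex e k)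
    have h3 := scale_pos (clusterIndex e k + 2)
    unfold meetTime
    linarith
  p_p := partner_partner he
  T_p k := by rw [meetTime, meetTime, clusterIndex_partner he]
  W_p k := by
    rw [clusterVel, clusterVel, partner_partner he, add_comm (m k), add_comm (m k • _)]
  meet := free_meet hn he
  balance k := by
    have h2 : m k + m (partner e k) ≠ 0 := (add_pos (hm _) (hm _)).ne'
    have h1 : clusterVel hn m e (partner e k) = clusterVel hn m e k := by
      rw [clusterVel, clusterVel, partner_partner he, add_comm (m k), add_comm (m k • _)]
    rw [h1, ← add_smul, clusterVel, smul_smul, mul_one_div_cancel h2, one_smul]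
  norm_w_le k := (norm_vel_le hn k).trans (by linarith [scale_le_one k])
  norm_W_le k := by
    have hA := hm k
    have hB := hm (partner e k)
    have h1 := (norm_vel_le hn k).trans (b := 2 * scale k) (c := 2) (by linarith [scale_le_one k])
    have h2 := (norm_vel_le hn (partner e k)).trans (c := 2)
      (by linarith [scale_le_one (partner e k)])
    rw [clusterVel, norm_smul, Real.norm_of_nonneg (by positivity), one_div_mul_eq_div,
      div_le_iff₀ (by positivity)]
    refine (norm_add_le _ _).trans ?_
    rw [norm_smul, norm_smul, Real.norm_of_nonneg hA.le, Real.norm_of_nonneg hB.le]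
    nlinarith
  r_le k := by
    have h1 := scale_pos (k + 3)
    have h2 := scale_le_one (k + 3)
    rw [radius, focusTime, scale_succ (k + 3)]
    nlinarith
  sep t ht k j z hk hj := by
    rcases lt_trichotomy (clusterIndex e k) (clusterIndex e j) with h | h | h
    · exact (not_clusterIndex_lt hn hm he ht hk hj h).elim
    · exact eq_or_partner_of_clusterIndex_eq hn he ht hk hj h.symm
    · exact (not_clusterIndex_lt hn hm he ht hj hk h).elim

/-- A series of smooth compactly supported functions is smooth if the coefficients decay fast
enough. -/
lemma exists_coeff_contDiff_tsum {F : Type*} [NormedAddCommGroup F] [NormedSpace ℝ F]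
    {g : ℕ → F → ℝ} (hg : ∀ k, ContDiff ℝ ((⊤ : ℕ∞) : WithTop ℕ∞) (g k))
    (hs : ∀ k, HasCompactSupport (g k)) :
    ∃ a : ℕ → ℝ, (∀ k, 0 < a k) ∧
      ContDiff ℝ ((⊤ : ℕ∞) : WithTop ℕ∞) (fun x => ∑' k, a k * g k x) := by
  have hb : ∀ k i : ℕ, ∃ B, 0 ≤ B ∧ ∀ x, ‖iteratedFDeriv ℝ i (g k) x‖ ≤ B := by
    intro k i
    have hc : Continuous (iteratedFDeriv ℝ i (g k)) :=
      (hg k).continuous_iteratedFDeriv (by exact_mod_cast le_top)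
    obtain ⟨B, hB⟩ := ((hs k).iteratedFDeriv i).exists_bound_of_continuous hc
    exact ⟨B, (norm_nonneg _).trans (hB 0), hB⟩
  choose B hB0 hB using hb
  have hS : ∀ k, 0 < 1 + ∑ i ∈ Finset.range (k + 1), B k i := fun k =>
    add_pos_of_pos_of_nonneg one_pos (Finset.sum_nonneg fun i _ => hB0 k i)
  refine ⟨fun k => scale k / (1 + ∑ i ∈ Finset.range (k + 1), B k i),
    fun k => div_pos (scale_pos k) (hS k), ?_⟩
  have hsum : Summable scale := summable_geometric_of_lt_one (by norm_num) (by norm_num)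
  refine contDiff_tsum_of_eventually (v := fun _ => scale) (fun k => contDiff_const.mul (hg k))
    (fun _ _ => hsum) fun i _ => ?_
  rw [Nat.cofinite_eq_atTop]
  filter_upwards [Filter.eventually_ge_atTop i] with k hk x
  have hi : ContDiffAt ℝ i (g k) x := ((hg k).of_le (by exact_mod_cast le_top)).contDiffAt
  have h1 := iteratedFDeriv_const_smul_apply
    (a := scale k / (1 + ∑ i ∈ Finset.range (k + 1), B k i)) hi
  change ‖iteratedFDeriv ℝ i ((scale k / (1 + ∑ i ∈ Finset.range (k + 1), B k i)) • g k) x‖ ≤ _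
  rw [h1, norm_smul, Real.norm_of_nonneg (div_pos (scale_pos k) (hS k)).le, div_mul_eq_mul_div,
    div_le_iff₀ (hS k)]
  refine mul_le_mul_of_nonneg_left ((hB k i x).trans ?_) (scale_pos k).le
  have := Finset.single_le_sum (f := fun i => B k i) (fun i _ => hB0 k i)
    (Finset.mem_range.2 (Nat.lt_succ_of_le hk))
  linarith

lemma blob_unique (hn : 2 ≤ n) {j k : ℕ} {z : E n} (hk : ‖z - pos hn k‖ ≤ radius k)
    (hj : ‖z - pos hn j‖ ≤ radius j) : j = k := by
  let C := pairing hn (fun _ => 1) (fun _ => one_pos) 0 (by omega)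
  have h0 : ∀ i, kinkPath (C.c i) (C.w i) (C.W i) (C.T i) 0 = C.c i := fun i => by
    have := (C.T_pos i).le
    simp [kinkPath, this]
  have h := C.sep 0 le_rfl k j z
    (by
      rw [h0, shrink_of_ge (C.τ_pos k) (C.τ_pos k).le, zero_div, sub_zero, one_mul]
      exact hk)
    (by
      rw [h0, shrink_of_ge (C.τ_pos j) (C.τ_pos j).le, zero_div, sub_zero, one_mul]
      exact hj)
  exact h.resolve_right fun h' => absurd h'.2 (not_le.2 (C.T_pos k))

/-- The profile of the density on the `k`-th blob. -/
noncomputable def densityBump (hn : 2 ≤ n) (k : ℕ) : ContDiffBump (pos hn k) where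
  rIn := radius k / 4
  rOut := radius k / 2
  rIn_pos := by have := radius_pos k; positivity
  rIn_lt_rOut := by have := radius_pos k; linarith

/-- A cut-off function for the velocity on the `k`-th blob. -/
noncomputable def velBump (hn : 2 ≤ n) (k : ℕ) : ContDiffBump (pos hn k) where
  rIn := radius k / 2
  rOut := radius k
  rIn_pos := by have := radius_pos k; positivity
  rIn_lt_rOut := by have := radius_pos k; linarith

/-- The support of the density of the `k`-th blob. -/
def blob (hn : 2 ≤ n) (k : ℕ) : Set (E n) := ball (pos hn k) (radius k / 2)

lemma measurableSet_blob (hn : 2 ≤ n) (k : ℕ) : MeasurableSet (blob hn k) := measurableSet_ball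

lemma norm_le_of_mem_blob (hn : 2 ≤ n) {k : ℕ} {x : E n} (hx : x ∈ blob hn k) :
    ‖x - pos hn k‖ ≤ radius k := by
  have h1 : ‖x - pos hn k‖ < radius k / 2 := by rwa [blob, mem_ball_iff_norm] at hx
  linarith [radius_pos k]

lemma densityBump_eq_zero (hn : 2 ≤ n) {k : ℕ} {x : E n} (hx : x ∉ blob hn k) :
    densityBump hn k x = 0 :=
  (densityBump hn k).zero_of_le_dist (not_lt.1 hx)

lemma radius_le_one (k : ℕ) : radius k ≤ 1 := pow_le_one₀ (scale_pos _).le (scale_le_one _)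

lemma blob_subset (hn : 2 ≤ n) (k : ℕ) : blob hn k ⊆ closedBall 0 3 := by
  intro x hx
  rw [mem_closedBall_zero_iff]
  have h1 := norm_le_of_mem_blob hn hx
  have h2 := norm_pos_le hn k
  have h3 := norm_le_norm_add_norm_sub' x (pos hn k)
  linarith [radius_le_one k]

/-- The initial velocity. -/
noncomputable def initVel (hn : 2 ≤ n) (x : E n) : E n :=
  ∑' k, velBump hn k x • (vel hn k - (1 / focusTime k) • (x - pos hn k))

lemma initVel_of_mem (hn : 2 ≤ n) {k : ℕ} {x : E n} (hx : x ∈ blob hn k) :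
    initVel hn x = vel hn k - (1 / focusTime k) • (x - pos hn k) := by
  rw [initVel, tsum_eq_single k]
  · rw [(velBump hn k).one_of_mem_closedBall (ball_subset_closedBall hx), one_smul]
  · intro j hj
    rw [(velBump hn j).zero_of_le_dist, zero_smul]
    by_contra h
    rw [not_le, dist_eq_norm] at h
    exact hj (blob_unique hn (norm_le_of_mem_blob hn hx) h.le)

lemma continuous_initVel (hn : 2 ≤ n) : Continuous (initVel hn) := by
  have hsum : Summable fun k => 3 * scale k :=
    (summable_geometric_of_lt_one (by norm_num) (by norm_num)).mul_left 3
  refine continuous_tsum (fun k => ?_) hsum fun k x => ?_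
  · exact (velBump hn k).continuous.smul (by fun_prop)
  · by_cases hx : radius k ≤ dist x (pos hn k)
    · rw [(velBump hn k).zero_of_le_dist hx, zero_smul, norm_zero]
      linarith [scale_pos k]
    · rw [not_le, dist_eq_norm] at hx
      have hτ : 0 < focusTime k := scale_pos _
      have h1 : ‖(1 / focusTime k) • (x - pos hn k)‖ ≤ scale k := by
        rw [norm_smul, Real.norm_of_nonneg (by positivity), one_div_mul_eq_div, div_le_iff₀ hτ]
        refine hx.le.trans ?_
        have h2 := scale_pos (k + 3)
        have h3 : scale (k + 3) ≤ scale k := scale_anti (by omega)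
        rw [radius, focusTime, scale_succ (k + 3)]
        nlinarith
      rw [norm_smul, Real.norm_of_nonneg (velBump hn k).nonneg]
      calc _ ≤ 1 * ‖vel hn k - (1 / focusTime k) • (x - pos hn k)‖ := by
            gcongr; exact (velBump hn k).le_one
        _ ≤ 3 * scale k := by
            rw [one_mul]
            exact (norm_sub_le _ _).trans (by linarith [norm_vel_le hn k])

lemma hasCompactSupport_initVel (hn : 2 ≤ n) : HasCompactSupport (initVel hn) := by
  refine HasCompactSupport.intro (isCompact_closedBall 0 3) fun x hx => ?_
  rw [mem_closedBall_zero_iff, not_le] at hx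
  have h0 : ∀ k, velBump hn k x = 0 := fun k => by
    refine (velBump hn k).zero_of_le_dist ?_
    have h2 := norm_pos_le hn k
    have h3 := norm_le_norm_add_norm_sub' x (pos hn k)
    have h4 := radius_le_one k
    rw [dist_eq_norm]
    change radius k ≤ _
    linarith
  simp [initVel, h0]

/-- The density with the amplitude `a k` on the `k`-th blob. -/
noncomputable def density (hn : 2 ≤ n) (a : ℕ → ℝ) (x : E n) : ℝ :=
  ∑' k, a k * densityBump hn k x

lemma density_of_mem (hn : 2 ≤ n) (a : ℕ → ℝ) {k : ℕ} {x : E n} (hx : x ∈ blob hn k) :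
    density hn a x = a k * densityBump hn k x := by
  refine tsum_eq_single k fun j hj => ?_
  rw [densityBump_eq_zero, mul_zero]
  exact fun h => hj (blob_unique hn (norm_le_of_mem_blob hn hx) (norm_le_of_mem_blob hn h))

lemma density_of_notMem (hn : 2 ≤ n) (a : ℕ → ℝ) {x : E n} (hx : x ∉ ⋃ k, blob hn k) :
    density hn a x = 0 := by
  rw [mem_iUnion, not_exists] at hx
  simp [density, fun k => densityBump_eq_zero hn (hx k)]

lemma density_nonneg (hn : 2 ≤ n) {a : ℕ → ℝ} (ha : ∀ k, 0 < a k) (x : E n) :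
    0 ≤ density hn a x :=
  tsum_nonneg fun k => mul_nonneg (ha k).le (densityBump hn k).nonneg

lemma density_pos (hn : 2 ≤ n) {a : ℕ → ℝ} (ha : ∀ k, 0 < a k) {k : ℕ} {x : E n}
    (hx : x ∈ blob hn k) : 0 < density hn a x := by
  rw [density_of_mem hn a hx]
  exact mul_pos (ha k) ((densityBump hn k).pos_of_mem_ball hx)

lemma hasCompactSupport_density (hn : 2 ≤ n) (a : ℕ → ℝ) : HasCompactSupport (density hn a) := by
  refine HasCompactSupport.intro (isCompact_closedBall 0 3) fun x hx => ?_
  exact density_of_notMem hn a fun h => hx (iUnion_subset (blob_subset hn) h)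

lemma exists_density (hn : 2 ≤ n) : ∃ a : ℕ → ℝ, (∀ k, 0 < a k) ∧
    ContDiff ℝ ((⊤ : ℕ∞) : WithTop ℕ∞) (density hn a) ∧ ∫ x, density hn a x = 1 := by
  obtain ⟨a, ha, hc⟩ := exists_coeff_contDiff_tsum (g := fun k x => densityBump hn k x)
    (fun k => (densityBump hn k).contDiff) (fun k => (densityBump hn k).hasCompactSupport)
  change ContDiff ℝ _ (density hn a) at hc
  have hpos : 0 < ∫ x, density hn a x :=
    hc.continuous.integral_pos_of_hasCompactSupport_nonneg_nonzero
      (hasCompactSupport_density hn a) (density_nonneg hn ha) (x := pos hn 0)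
      (density_pos hn ha (mem_ball_self (half_pos (radius_pos 0)))).ne'
  have heq : density hn (fun k => (∫ x, density hn a x)⁻¹ * a k) =
      fun x => (∫ x, density hn a x)⁻¹ * density hn a x := by
    ext x
    simp only [density, mul_assoc, tsum_mul_left]
  refine ⟨fun k => (∫ x, density hn a x)⁻¹ * a k, fun k => mul_pos (inv_pos.2 hpos) (ha k), ?_, ?_⟩
  · rw [heq]
    exact contDiff_const.mul hc
  · rw [heq, integral_const_mul, inv_mul_cancel₀ hpos.ne']

/-- The initial mass distribution. -/
noncomputable def initMass (hn : 2 ≤ n) (a : ℕ → ℝ) : Measure (E n) :=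
  volume.withDensity fun x => ENNReal.ofReal (density hn a x)

lemma isProbabilityMeasure_initMass (hn : 2 ≤ n) {a : ℕ → ℝ} (ha : ∀ k, 0 < a k)
    (hc : Continuous (density hn a)) (h1 : ∫ x, density hn a x = 1) :
    IsProbabilityMeasure (initMass hn a) := by
  constructor
  rw [initMass, withDensity_apply _ MeasurableSet.univ, setLIntegral_univ,
    ← ofReal_integral_eq_lintegral_ofReal
      (hc.integrable_of_hasCompactSupport (hasCompactSupport_density hn a))
      (Filter.Eventually.of_forall (density_nonneg hn ha)), h1, ENNReal.ofReal_one]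

lemma initMass_blob_ne_zero (hn : 2 ≤ n) {a : ℕ → ℝ} (ha : ∀ k, 0 < a k)
    (hc : Continuous (density hn a)) (k : ℕ) : initMass hn a (blob hn k) ≠ 0 := by
  intro h
  rw [initMass, withDensity_apply_eq_zero (by fun_prop)] at h
  refine (measure_ball_pos volume (pos hn k) (half_pos (radius_pos k))).ne'
    (measure_mono_null (fun x hx => ?_) h)
  exact ⟨(ENNReal.ofReal_pos.2 (density_pos hn ha hx)).ne', hx⟩

lemma initMass_compl_blobs (hn : 2 ≤ n) {a : ℕ → ℝ}
    (hc : Continuous (density hn a)) : initMass hn a (⋃ k, blob hn k)ᶜ = 0 := by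
  rw [initMass, withDensity_apply_eq_zero (by fun_prop)]
  convert measure_empty (μ := (volume : Measure (E n)))
  ext x
  simp only [mem_inter_iff, mem_ofPred_eq, mem_compl_iff, mem_empty_iff_false, iff_false, not_and,
    not_not]
  intro h
  by_contra hx
  simp [density_of_notMem hn a hx] at h

lemma setIntegral_blob_sub (hn : 2 ≤ n) {a : ℕ → ℝ} (ha : ∀ k, 0 < a k)
    (hc : Continuous (density hn a)) (k : ℕ) :
    ∫ x in blob hn k, (x - pos hn k) ∂(initMass hn a) = 0 := by
  have hm := measurableSet_blob hn k
  rw [initMass, setIntegral_withDensity_eq_setIntegral_toReal_smul (by fun_prop)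
    (Filter.Eventually.of_forall fun x => ENNReal.ofReal_lt_top) _ hm]
  have h1 : ∫ x in blob hn k, (ENNReal.ofReal (density hn a x)).toReal • (x - pos hn k) =
      ∫ x in blob hn k, a k • densityBump hn k x • (x - pos hn k) := by
    refine setIntegral_congr_fun hm fun x hx => ?_
    rw [ENNReal.toReal_ofReal (density_nonneg hn ha x), density_of_mem hn a hx, mul_smul]
  have h2 : ∫ x in blob hn k, densityBump hn k x • (x - pos hn k) =
      ∫ x, densityBump hn k x • (x - pos hn k) :=
    setIntegral_eq_integral_of_forall_compl_eq_zero fun x hx => by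
      rw [densityBump_eq_zero hn hx, zero_smul]
  have h3 : ∫ x, densityBump hn k x • (x - pos hn k) = 0 := by
    have h4 := integral_sub_left_eq_self (fun x => densityBump hn k x • (x - pos hn k)) volume
      (pos hn k + pos hn k)
    have h5 : ∀ x, densityBump hn k (pos hn k + pos hn k - x) •
        (pos hn k + pos hn k - x - pos hn k) = -(densityBump hn k x • (x - pos hn k)) := by
      intro x
      have h6 := (densityBump hn k).sub (x - pos hn k)
      have h7 : pos hn k - (x - pos hn k) = pos hn k + pos hn k - x := by abel
      rw [h7, add_sub_cancel] at h6
      rw [h6, ← smul_neg]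
      congr 1
      abel
    simp only [h5, integral_neg] at h4
    have h8 := neg_eq_iff_add_eq_zero.1 h4
    rw [← two_smul ℝ] at h8
    exact (smul_eq_zero.1 h8).resolve_left two_ne_zero
  rw [h1, integral_smul, h2, h3, smul_zero]

/-- The open unit cube. -/
def unitCube (n : ℕ) : Set (E n) := WithLp.ofLp ⁻¹' (univ.pi fun _ : Fin n => Ioo (0 : ℝ) 1)

lemma isOpen_unitCube (n : ℕ) : IsOpen (unitCube n) :=
  (isOpen_set_pi finite_univ fun _ _ => isOpen_Ioo).preimage (PiLp.continuous_ofLp 2 _)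

lemma volume_unitCube (n : ℕ) : volume (unitCube n) = 1 := by
  rw [unitCube, (PiLp.volume_preserving_ofLp (Fin n)).measure_preimage
    (MeasurableSet.univ_pi fun _ => measurableSet_Ioo).nullMeasurableSet, volume_pi_pi]
  simp

/-- Each probability measure on a standard Borel space is the image of Lebesgue measure on the unit
cube. -/
lemma exists_map_unitCube_eq {Y : Type*} [MeasurableSpace Y] [StandardBorelSpace Y] [Nonempty Y]
    (hn : 0 < n) (μ : Measure Y) [IsProbabilityMeasure μ] :
    ∃ f : E n → Y, Measurable f ∧ (volume.restrict (unitCube n)).map f = μ := by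
  obtain ⟨f, hf, hμ⟩ := μ.exists_measurable_map_eq
  have : IsProbabilityMeasure ((volume : Measure ℝ).restrict (Ioo 0 1)) := ⟨by simp⟩
  have h1 : MeasurePreserving (WithLp.ofLp : E n → (Fin n → ℝ)) (volume.restrict (unitCube n))
      (Measure.pi fun _ => volume.restrict (Ioo 0 1)) := by
    have h := (PiLp.volume_preserving_ofLp (Fin n)).restrict_preimage
      (MeasurableSet.univ_pi fun _ : Fin n => measurableSet_Ioo (a := (0 : ℝ)) (b := 1))
    rwa [volume_pi, Measure.restrict_pi_pi] at h
  have h2 := measurePreserving_eval (fun _ : Fin n => (volume : Measure ℝ).restrict (Ioo 0 1))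
    ⟨0, hn⟩
  have h3 : MeasurePreserving (projIcc (0 : ℝ) 1 zero_le_one) (volume.restrict (Ioo 0 1))
      volume := by
    refine ⟨continuous_projIcc.measurable, ?_⟩
    rw [Measure.restrict_congr_set Ioo_ae_eq_Icc, ← map_comap_subtype_coe measurableSet_Icc,
      Measure.map_map continuous_projIcc.measurable measurable_subtype_coe]
    have : projIcc (0 : ℝ) 1 zero_le_one ∘ ((↑) : Icc (0 : ℝ) 1 → ℝ) = id := by
      ext x; simp
    rw [this, Measure.map_id]
    rfl
  have h4 := (h3.comp h2).comp h1
  refine ⟨f ∘ _, hf.comp h4.measurable, ?_⟩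
  rw [← Measure.map_map hf h4.measurable, h4.map_eq, hμ]

/-- Lagrangian coordinates for the initial mass distribution. -/
lemma exists_labelling (hn : 2 ≤ n) {a : ℕ → ℝ} (ha : ∀ k, 0 < a k)
    (hc : Continuous (density hn a)) (h1 : ∫ x, density hn a x = 1) :
    ∃ (m : ℕ → ℝ) (hm : ∀ k, 0 < m k) (f : E n → E n) (κ : E n → ℕ),
      (volume.restrict (unitCube n)).map f = initMass hn a ∧
      (∀ y, f y ∈ blob hn (κ y)) ∧
      ∀ e he, IsLabelling (pairing hn m hm e he) (unitCube n) f κ := by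
  classical
  have hprob := isProbabilityMeasure_initMass hn ha hc h1
  obtain ⟨g, hg, hgμ⟩ := exists_map_unitCube_eq (n := n) (by omega) (initMass hn a)
  have hU : MeasurableSet (⋃ k, blob hn k) := MeasurableSet.iUnion (measurableSet_blob hn)
  let f : E n → E n := fun y => if g y ∈ ⋃ k, blob hn k then g y else pos hn 0
  have hf : Measurable f := Measurable.ite (hg hU) hg measurable_const
  have hfμ : (volume.restrict (unitCube n)).map f = initMass hn a := by
    rw [← hgμ]
    refine Measure.map_congr ?_
    have h2 : ∀ᵐ x ∂(initMass hn a), x ∈ ⋃ k, blob hn k := initMass_compl_blobs hn hc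
    rw [← hgμ] at h2
    filter_upwards [ae_of_ae_map hg.aemeasurable h2] with y hy
    exact if_pos hy
  have hex : ∀ y, ∃ k, f y ∈ blob hn k := by
    intro y
    by_cases hy : g y ∈ ⋃ k, blob hn k
    · simp only [f, if_pos hy]
      exact mem_iUnion.1 hy
    · simp only [f, if_neg hy]
      exact ⟨0, mem_ball_self (half_pos (radius_pos 0))⟩
  let κ : E n → ℕ := fun y => Nat.find (hex y)
  have hmem : ∀ y, f y ∈ blob hn (κ y) := fun y => Nat.find_spec (hex y)
  have hκ : Measurable κ := measurable_find hex fun k => hf measurableSet_ball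
  have hpre : ∀ k, κ ⁻¹' {k} = f ⁻¹' blob hn k := by
    intro k
    ext y
    refine ⟨fun hy => ?_, fun hy => ?_⟩
    · have hy : κ y = k := hy
      exact hy ▸ hmem y
    · exact blob_unique hn (norm_le_of_mem_blob hn hy) (norm_le_of_mem_blob hn (hmem y))
  refine ⟨fun k => (initMass hn a).real (blob hn k), fun k => ?_, f, κ, hfμ, hmem, fun e he => ?_⟩
  · exact ENNReal.toReal_pos (initMass_blob_ne_zero hn ha hc k) (measure_ne_top _ _)
  · refine ⟨isOpen_unitCube n, volume_unitCube n, hf, hκ,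
      fun y => norm_le_of_mem_blob hn (hmem y), fun k => ?_, fun k => ?_⟩
    · change _ = (initMass hn a).real (blob hn k)
      rw [hpre, ← hfμ, map_measureReal_apply hf (measurableSet_blob hn k)]
    · change ∫ y in κ ⁻¹' {k}, (f y - pos hn k) ∂_ = 0
      have h3 := setIntegral_blob_sub hn ha hc k
      rw [← hfμ, setIntegral_map (measurableSet_blob hn k)
        (by fun_prop : Continuous fun x : E n => x - pos hn k).aestronglyMeasurable
        hf.aemeasurable] at h3
      rw [hpre, h3]

namespace Clustering

variable {C : Clustering n} {D : Set (E n)} {f : E n → E n} {κ : E n → ℕ}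

lemma massAt_singleton (h : IsLabelling C D f κ) (t : ℝ) (z : E n) :
    (massAt D (C.flow f κ) t).real {z} = (volume.restrict D).real {y | C.flow f κ t y = z} :=
  map_measureReal_apply (measurable_flow h t) (measurableSet_singleton z)

/-- After the merger, the cluster of `k` carries the mass of `k` and of its partner. -/
lemma le_massAt_center (h : IsLabelling C D f κ) {k : ℕ} (hk : C.p k ≠ k) {t : ℝ}
    (ht : C.T k ≤ t) : C.m k + C.m (C.p k) ≤ (massAt D (C.flow f κ) t).real {C.center k t} := by
  have := isProbabilityMeasure_restrict h
  have hd : Disjoint (κ ⁻¹' {k}) (κ ⁻¹' {C.p k}) :=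
    Disjoint.preimage κ (by simpa using hk.symm)
  rw [massAt_singleton h, ← h.mass, ← h.mass,
    ← measureReal_union hd (h.measurable_κ (measurableSet_singleton _))]
  refine measureReal_mono ?_
  rintro y (hy | hy)
  · have hy : κ y = k := hy
    change C.traj (κ y) t (f y) = _
    rw [hy, C.traj_of_le ((C.τ_le k).trans ht)]
  · have hy : κ y = C.p k := hy
    have h1 := C.τ_le (C.p k)
    rw [C.T_p] at h1
    change C.traj (κ y) t (f y) = _
    rw [hy, C.traj_of_le (h1.trans ht), C.center_partner ht]

/-- Before the merger, the position of the particle `k` carries at most its own mass. -/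
lemma massAt_center_le (h : IsLabelling C D f κ) {k : ℕ} (hr : 0 ≤ C.r k) {t : ℝ} (ht0 : 0 ≤ t)
    (ht : t < C.T k) : (massAt D (C.flow f κ) t).real {C.center k t} ≤ C.m k := by
  have := isProbabilityMeasure_restrict h
  rw [massAt_singleton h, ← h.mass]
  refine measureReal_mono fun y hy => ?_
  have hy : C.traj (κ y) t (f y) = C.center k t := hy
  have h1 := C.norm_traj_sub_center_le (h.mem y) t
  rw [hy] at h1
  refine (C.sep t ht0 k (κ y) (C.center k t) ?_ h1).resolve_right
    fun h2 => absurd h2.2 (not_le.2 ht)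
  change ‖C.center k t - C.center k t‖ ≤ _
  rw [sub_self, norm_zero]
  exact mul_nonneg (shrink_nonneg _ _) hr

end Clustering

lemma exists_meetTime_le {T : ℝ} (hT : 0 < T) : ∃ j, meetTime 0 (2 * j) ≤ T := by
  obtain ⟨j, hj⟩ := exists_pow_lt_of_lt_one hT (by norm_num : (1 / 2 : ℝ) < 1)
  refine ⟨j, ?_⟩
  have h0 : clusterIndex 0 (2 * j) = 2 * j + 1 := clusterIndex_of_even (by omega)
  have h1 : scale (2 * j + 1 + 2) ≤ scale (2 * j + 1) := scale_anti (by omega)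
  have h2 : scale (2 * j) ≤ scale j := scale_anti (by omega)
  have h3 : scale j < T := hj
  rw [meetTime, h0]
  rw [scale_succ (2 * j)] at h1 ⊢
  linarith

/-- The two pairings give different mass distributions at the time when the particles `2 j` and
`2 j + 1` meet. -/
lemma massAt_ne (hn : 2 ≤ n) {m : ℕ → ℝ} (hm : ∀ k, 0 < m k) {D : Set (E n)} {f : E n → E n}
    {κ : E n → ℕ} (h : ∀ e he, IsLabelling (pairing hn m hm e he) D f κ) (j : ℕ) :
    massAt D ((pairing hn m hm 0 zero_le_one).flow f κ) (meetTime 0 (2 * j)) ≠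
      massAt D ((pairing hn m hm 1 le_rfl).flow f κ) (meetTime 0 (2 * j)) := by
  intro heq
  have h0 : clusterIndex 0 (2 * j) = 2 * j + 1 := clusterIndex_of_even (by omega)
  have h1 : clusterIndex 1 (2 * j) = 2 * j := clusterIndex_of_odd (by omega)
  have hlt : meetTime 0 (2 * j) < meetTime 1 (2 * j) := by
    rw [meetTime, meetTime, h0, h1, scale_succ (2 * j + 2), scale_succ (2 * j)]
    linarith [scale_pos (2 * j), scale_pos (2 * j + 2)]
  have hp : partner 0 (2 * j) = 2 * j + 1 := if_pos (by omega)
  have hpos : 0 ≤ meetTime 0 (2 * j) := (add_pos (scale_pos _) (scale_pos _)).le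
  have i1 := Clustering.le_massAt_center (h 0 zero_le_one) (k := 2 * j)
    (by change partner 0 (2 * j) ≠ _; omega) (le_refl (meetTime 0 (2 * j)))
  have i2 := Clustering.massAt_center_le (h 1 le_rfl) (k := 2 * j) (radius_pos _).le hpos hlt
  have hz : (pairing hn m hm 0 zero_le_one).center (2 * j) (meetTime 0 (2 * j)) =
      (pairing hn m hm 1 le_rfl).center (2 * j) (meetTime 0 (2 * j)) :=
    (center_of_le hn m _ le_rfl).trans (center_of_le hn m _ hlt.le).symm
  change m _ + m (partner 0 (2 * j)) ≤ _ at i1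
  change _ ≤ m _ at i2
  rw [heq, hz] at i1
  linarith [hm (partner 0 (2 * j))]

end PressurelessGas

theorem theorem2 (n : ℕ) (hn : 2 ≤ n) :
    ∃ (ρ₀ : PressurelessGas.E n → ℝ) (v₀ : PressurelessGas.E n → PressurelessGas.E n),
      ContDiff ℝ ((⊤ : ℕ∞) : WithTop ℕ∞) ρ₀ ∧ HasCompactSupport ρ₀ ∧
      (∀ x, 0 ≤ ρ₀ x) ∧ ∫ x, ρ₀ x = 1 ∧
      Continuous v₀ ∧ HasCompactSupport v₀ ∧
      ∀ T : ℝ, 0 < T →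
        ∃ (D : Set (PressurelessGas.E n))
          (X₁ X₂ : ℝ → PressurelessGas.E n → PressurelessGas.E n),
          PressurelessGas.IsStickyWeakSolution T
            (volume.withDensity (fun x => ENNReal.ofReal (ρ₀ x))) v₀ D X₁ ∧
          PressurelessGas.IsStickyWeakSolution T
            (volume.withDensity (fun x => ENNReal.ofReal (ρ₀ x))) v₀ D X₂ ∧
          ∃ t ∈ Set.Icc 0 T,
            PressurelessGas.massAt D X₁ t ≠ PressurelessGas.massAt D X₂ t := by
  open PressurelessGas in
  obtain ⟨a, ha, hc, h1⟩ := exists_density hn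
  obtain ⟨m, hm, f, κ, hμ, hmem, hL⟩ := exists_labelling hn ha hc.continuous h1
  refine ⟨density hn a, initVel hn, hc, hasCompactSupport_density hn a, density_nonneg hn ha, h1,
    continuous_initVel hn, hasCompactSupport_initVel hn, fun T hT => ?_⟩
  obtain ⟨j, hj⟩ := exists_meetTime_le hT
  have hsol : ∀ e he, IsStickyWeakSolution T (initMass hn a) (initVel hn) (unitCube n)
      ((pairing hn m hm e he).flow f κ) := fun e he =>
    Clustering.isStickyWeakSolution (hL e he) hμ (fun y => initVel_of_mem hn (hmem y))
      (continuous_initVel hn).measurable T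
  exact ⟨unitCube n, _, _, hsol 0 zero_le_one, hsol 1 le_rfl, meetTime 0 (2 * j),
    ⟨(add_pos (scale_pos _) (scale_pos _)).le, hj⟩, massAt_ne hn hm hL j⟩
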